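/- Let $R$ be a (left and right) noetherian, semiperfect, basic ring. Here $R$ is semiperfect if $R/\operatorname{rad} R$ is a semisimple ring and idempotents lift modulo the Jacobson radical $\operatorname{rad} R$; it is basic if $1$ is a sum of pairwise orthogonal primitive idempotents $e_1,\dots,e_m$ such that the right modules $e_1R,\dots,e_mR$ are pairwise non-isomorphic. All modules are right modules. For an idempotent $f\in R$ put $\Gamma_f := (1-f)R(1-f)$, a ring with unit $1-f$, and $S_f := fR/\operatorname{rad}(fR)$, a semisimple right $R$-module. Let $e\in R$ be an idempotent such that the quotient ring $R/\langle 1-e\rangle$ of $R$ by the two-sided ideal generated by $1-e$ is right artinian. Suppose that for every idempotent $e'\in R$ with $e'e=ee'=e'$ (equivalently, $\Gamma_e\subset\Gamma_{e'}\subset R$) the ring $\Gamma_{e'}$ has finite global dimension. Then there is a decomposition $$S_e = S_1\oplus\cdots\oplus S_n$$ into simple summands such that $\operatorname{Ext}_R^k(S_i,S_j)=0$ for all $1\le j\le i\le n$ and all $k>0$. -/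

import Mathlib

universe u

/-- A ring `R` with Jacobson radical `J` is semiperfect if `R ⧸ J` is semisimple and every
idempotent of `R ⧸ J` lifts to an idempotent of `R`. -/
structure IsSemiperfectRing (R : Type u) [Ring R] : Prop where
  isSemisimpleRing_quotient : IsSemisimpleRing (R ⧸ Ring.jacobson R)
  exists_lift : ∀ x : R ⧸ Ring.jacobson R, IsIdempotentElem x →
    ∃ f : R, IsIdempotentElem f ∧ Ideal.Quotient.mk (Ring.jacobson R) f = x

/-- A nonzero idempotent that is not the sum of two nonzero orthogonal idempotents. -/
structure IsPrimitiveIdempotentElem {R : Type u} [Ring R] (e : R) : Prop where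
  isIdempotentElem : IsIdempotentElem e
  ne_zero : e ≠ 0
  eq_zero_or_eq_zero : ∀ f g : R, IsIdempotentElem f → IsIdempotentElem g →
    f * g = 0 → g * f = 0 → e = f + g → f = 0 ∨ g = 0

/-- The right `R`-module `eR`; right modules are modules over `Rᵐᵒᵖ`. -/
def idempotentRightIdeal {R : Type u} [Ring R] (e : R) : Submodule Rᵐᵒᵖ R :=
  Submodule.span Rᵐᵒᵖ {e}

/-- A (semiperfect) ring is basic if `1` is a sum of pairwise orthogonal primitive idempotents
`e i` such that the right modules `(e i)R` are pairwise nonisomorphic. -/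
def IsBasicRing (R : Type u) [Ring R] : Prop :=
  ∃ (n : ℕ) (e : Fin n → R), CompleteOrthogonalIdempotents e ∧
    (∀ i, IsPrimitiveIdempotentElem (e i)) ∧
    ∀ i j, Nonempty (idempotentRightIdeal (e i) ≃ₗ[Rᵐᵒᵖ] idempotentRightIdeal (e j)) → i = j

/-- The right module `S_e = eR / rad(eR)`. -/
abbrev topOfIdempotent {R : Type u} [Ring R] (e : R) : Type u :=
  idempotentRightIdeal e ⧸ Module.jacobson Rᵐᵒᵖ (idempotentRightIdeal e)

/-- The idempotent subring `Γ_e = (1 - e)R(1 - e)`, with unit `1 - e`. -/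
abbrev idempotentSubring {R : Type u} [Ring R] {e : R} (he : IsIdempotentElem e) : Type u :=
  he.one_sub.Corner

/-- An idempotent `e'` is sandwiched between `e` and `1` if `e' * e = e * e' = e'`. -/
structure IsSandwiched {R : Type u} [Ring R] (e e' : R) : Prop where
  mul_right_eq : e' * e = e'
  mul_left_eq : e * e' = e'

/-- `e'` is sandwiched between `e` and `1` if and only if `Γ_e ⊆ Γ_{e'}` inside `R`. -/
theorem isSandwiched_iff {R : Type u} [Ring R] {e e' : R} (he : IsIdempotentElem e)
    (he' : IsIdempotentElem e') :
    IsSandwiched e e' ↔ Subsemigroup.corner (1 - e) ≤ Subsemigroup.corner (1 - e') := by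
  constructor
  · rintro ⟨h1, h2⟩ r hr
    rw [Subsemigroup.mem_corner_iff he.one_sub] at hr
    rw [Subsemigroup.mem_corner_iff he'.one_sub]
    have a : (1 - e') * (1 - e) = 1 - e := by
      rw [sub_mul, mul_sub e', h1]; simp
    have b : (1 - e) * (1 - e') = 1 - e := by
      rw [mul_sub, sub_mul 1 e e', h2]; simp
    constructor
    · rw [← hr.1, ← mul_assoc, a]
    · rw [← hr.2, mul_assoc, b]
  · intro h
    have h1 : (1 - e) ∈ Subsemigroup.corner (1 - e') :=
      h ((Subsemigroup.mem_corner_iff he.one_sub).2 ⟨he.one_sub, he.one_sub⟩)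
    rw [Subsemigroup.mem_corner_iff he'.one_sub] at h1
    obtain ⟨a, b⟩ := h1
    constructor
    · rw [sub_mul, mul_sub e'] at a
      simp only [one_mul, mul_one, sub_eq_self, sub_eq_zero] at a
      exact a.symm
    · rw [mul_sub, sub_mul 1 e e'] at b
      simp only [one_mul, mul_one, sub_eq_self, sub_eq_zero] at b
      exact b.symm

/-- The right global dimension: the supremum of the projective dimensions of all right modules. -/
noncomputable def rightGlobalDimension (A : Type u) [Ring A] : WithBot ℕ∞ :=
  ⨆ M : ModuleCat.{u} Aᵐᵒᵖ, CategoryTheory.projectiveDimension M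

/-! Right `R`-modules are left modules over `A = Rᵐᵒᵖ`. Since `R` is basic and semiperfect, `e` is a
sum of idempotents `c i`, `i ∈ I`, from a complete orthogonal family with local corners. The simple
summands `S i` of `S_e` are indexed by `I`. Write `i → j` if `Ext^k(S i, S j) ≠ 0` for some `k > 0`.
The required order exists once every nonempty subset of `I` contains an element with no arrow into
that subset, not even a loop: put it last and recurse (`exists_order_extVanishes`).

The engine is the deletion of one idempotent `e a`. Put `f = 1 - e a` and `Γ = fAf`. Because
`R/⟨1-e⟩` is artinian, every module killed by `f` ("corner torsion") has a finite filtration whose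
layers are direct sums of copies of `S a`. Given `N`, let `l` be the largest degree with `Ext^l(S a,
N) ≠ 0`; it exists, if there is any such degree, because `A` has finite global dimension. Then
`Ext^t(-, N)` kills all corner torsion modules for `t > l`, while `Ext^l(-, N)` kills none but zero.
Now let `fM` have no positive extensions by `fN` over `Γ`, and let maps `fM → fN` lift to maps `M →
N`. Resolve `fM` over `Γ`, where it has finite projective dimension, by modules `fQ` with `Q`
projective and generated by `fQ`. Either all torsion defects of this resolution vanish, and `M` has
no extensions by torsion modules in any degree; or a nonzero defect `L` occurs, and `Ext^l(L, N) ≠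
0` propagates to `Ext^t(M, N) ≠ 0` for some `t ≥ l`. This dichotomy is
`isCornerOrthogonal_or_exists_not_extVanishes`.

Loops are excluded by the dichotomy for `M = A`, `N = S a` (`IsSimpleSystem.extVanishes_self`). The
sink is found by induction on `I` (`exists_forall_extVanishes`). If there is none, the induction
hypothesis for the sets `I \ {a}` forces `→` to be a fixed-point-free permutation of `I`. The
induction hypothesis for a corner ring `Γ` then gives `s ≠ a` without extensions over `Γ` by the
other simples, and the dichotomy for `M = S s` contradicts the uniqueness of the successor of `s`.
-/

open CategoryTheory

/-! ### Vanishing of Ext along short exact sequences -/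

section ExtVanishing

variable {A : Type u} [Ring A]

/-- The vanishing of `Ext^k_A(M, N)`. -/
abbrev ExtVanishes (A : Type u) [Ring A] (M N : Type u) [AddCommGroup M] [Module A M]
    [AddCommGroup N] [Module A N] (k : ℕ) : Prop :=
  Subsingleton (Abelian.Ext.{u} (ModuleCat.of A M) (ModuleCat.of A N) k)

variable {M₁ M₂ M₃ N : Type u} [AddCommGroup M₁] [AddCommGroup M₂] [AddCommGroup M₃]
  [AddCommGroup N] [Module A M₁] [Module A M₂] [Module A M₃] [Module A N]

theorem extVanishes_zero_iff : ExtVanishes A M₁ N 0 ↔ ∀ g : M₁ →ₗ[A] N, g = 0 := by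
  rw [ExtVanishes, Abelian.Ext.addEquiv₀.toEquiv.subsingleton_congr]
  constructor
  · intro h g
    have := Subsingleton.elim (ModuleCat.ofHom g) (ModuleCat.ofHom 0)
    exact congrArg ModuleCat.Hom.hom this
  · intro h
    exact ⟨fun a b => ModuleCat.hom_ext ((h a.hom).trans (h b.hom).symm)⟩

theorem ExtVanishes.congr {k : ℕ} (h : ExtVanishes A M₁ N k) (e : M₁ ≃ₗ[A] M₂) :
    ExtVanishes A M₂ N k := by
  refine ⟨fun a b => ?_⟩
  have key : ∀ a : Abelian.Ext.{u} (ModuleCat.of A M₂) (ModuleCat.of A N) k, a = 0 := by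
    intro a
    have h1 : (Abelian.Ext.mk₀ e.toModuleIso.hom).comp a (zero_add k) = 0 := Subsingleton.elim _ _
    have h2 := congrArg (fun t => (Abelian.Ext.mk₀ e.toModuleIso.inv).comp t (zero_add k)) h1
    rw [Abelian.Ext.mk₀_comp_mk₀_assoc, Iso.inv_hom_id] at h2
    simpa using h2
  rw [key a, key b]

theorem ExtVanishes.of_projective [Module.Projective A M₁] {k : ℕ} (hk : 0 < k) :
    ExtVanishes A M₁ N k := by
  have : Projective (ModuleCat.of A M₁) := (IsProjective.iff_projective (R := A) M₁).1 inferInstance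
  exact HasProjectiveDimensionLT.subsingleton _ 1 k hk _

theorem ExtVanishes.of_subsingleton [Subsingleton M₁] (k : ℕ) : ExtVanishes A M₁ N k := by
  have := (ModuleCat.isZero_of_subsingleton (ModuleCat.of A M₁)).hasProjectiveDimensionLT_zero
  exact HasProjectiveDimensionLT.subsingleton _ 0 k (Nat.zero_le _) _

/-- The short exact sequence of module objects given by linear maps. -/
theorem moduleCat_shortExact {i : M₁ →ₗ[A] M₂} {p : M₂ →ₗ[A] M₃} (hi : Function.Injective i)
    (hp : Function.Surjective p) (hip : Function.Exact i p) :
    (ShortComplex.mk (ModuleCat.ofHom i) (ModuleCat.ofHom p)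
      (ModuleCat.hom_ext hip.linearMap_comp_eq_zero)).ShortExact := by
  have := (ModuleCat.mono_iff_injective (ModuleCat.ofHom i)).2 hi
  have := (ModuleCat.epi_iff_surjective (ModuleCat.ofHom p)).2 hp
  exact ⟨(ShortComplex.ShortExact.moduleCat_exact_iff_function_exact _).2 hip⟩

variable {i : M₁ →ₗ[A] M₂} {p : M₂ →ₗ[A] M₃}

theorem ExtVanishes.left (hi : Function.Injective i)
    (hp : Function.Surjective p) (hip : Function.Exact i p) {k : ℕ}
    (h₂ : ExtVanishes A M₂ N k) (h₃ : ExtVanishes A M₃ N (k + 1)) : ExtVanishes A M₁ N k := by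
  have hS := moduleCat_shortExact hi hp hip
  refine subsingleton_of_forall_eq 0 fun x => ?_
  obtain ⟨y, rfl⟩ := Abelian.Ext.contravariant_sequence_exact₁ hS _ x (add_comm 1 k)
    (@Subsingleton.elim _ h₃ _ _)
  rw [@Subsingleton.elim _ h₂ y 0]; simp

theorem ExtVanishes.middle (hi : Function.Injective i)
    (hp : Function.Surjective p) (hip : Function.Exact i p) {k : ℕ}
    (h₁ : ExtVanishes A M₁ N k) (h₃ : ExtVanishes A M₃ N k) : ExtVanishes A M₂ N k := by
  have hS := moduleCat_shortExact hi hp hip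
  refine subsingleton_of_forall_eq 0 fun x => ?_
  obtain ⟨y, rfl⟩ := Abelian.Ext.contravariant_sequence_exact₂ hS _ x
    (@Subsingleton.elim _ h₁ _ _)
  rw [@Subsingleton.elim _ h₃ y 0]; simp

theorem ExtVanishes.right (hi : Function.Injective i)
    (hp : Function.Surjective p) (hip : Function.Exact i p) {k : ℕ}
    (h₁ : ExtVanishes A M₁ N k) (h₂ : ExtVanishes A M₂ N (k + 1)) :
    ExtVanishes A M₃ N (k + 1) := by
  have hS := moduleCat_shortExact hi hp hip
  refine subsingleton_of_forall_eq 0 fun x => ?_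
  obtain ⟨y, rfl⟩ := Abelian.Ext.contravariant_sequence_exact₃ hS _ x
    (@Subsingleton.elim _ h₂ _ _) (add_comm 1 k)
  rw [@Subsingleton.elim _ h₁ y 0]; simp

/-- `Ext¹(M₃, N) = 0` if every map `M₁ → N` extends to `M₂` and `Ext¹(M₂, N) = 0`. -/
theorem ExtVanishes.right_one (hi : Function.Injective i)
    (hp : Function.Surjective p) (hip : Function.Exact i p)
    (h : ∀ g : M₁ →ₗ[A] N, ∃ g' : M₂ →ₗ[A] N, g' ∘ₗ i = g)
    (h₂ : ExtVanishes A M₂ N 1) : ExtVanishes A M₃ N 1 := by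
  have hS := moduleCat_shortExact hi hp hip
  refine subsingleton_of_forall_eq 0 fun x => ?_
  obtain ⟨y, rfl⟩ := Abelian.Ext.contravariant_sequence_exact₃ hS _ x
    (@Subsingleton.elim _ h₂ _ _) (add_zero 1)
  obtain ⟨g, rfl⟩ := Abelian.Ext.mk₀_bijective _ _ |>.2 y
  obtain ⟨g', hg'⟩ := h g.hom
  have : g = ModuleCat.ofHom i ≫ ModuleCat.ofHom g' := ModuleCat.hom_ext hg'.symm
  rw [this, ← Abelian.Ext.mk₀_comp_mk₀]
  simpa using congrArg (fun t => Abelian.Ext.comp t (Abelian.Ext.mk₀ (ModuleCat.ofHom g')) (add_zero 1))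
    hS.extClass_comp

theorem exists_extension_of_extVanishes_one (hi : Function.Injective i)
    (hp : Function.Surjective p) (hip : Function.Exact i p)
    (h₃ : ExtVanishes A M₃ N 1) (g : M₁ →ₗ[A] N) : ∃ g' : M₂ →ₗ[A] N, g' ∘ₗ i = g := by
  have hS := moduleCat_shortExact hi hp hip
  obtain ⟨y, hy⟩ := Abelian.Ext.contravariant_sequence_exact₁ hS _
    (Abelian.Ext.mk₀ (ModuleCat.ofHom g)) (add_zero 1) (@Subsingleton.elim _ h₃ _ _)
  obtain ⟨g', rfl⟩ := Abelian.Ext.mk₀_bijective _ _ |>.2 y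
  rw [Abelian.Ext.mk₀_comp_mk₀] at hy
  have := (Abelian.Ext.mk₀_bijective _ _).1 hy
  exact ⟨g'.hom, congrArg ModuleCat.Hom.hom this⟩

theorem exists_free_presentation (A M : Type u) [Ring A] [AddCommGroup M] [Module A M] :
    ∃ (K P : Type u) (_ : AddCommGroup K) (_ : AddCommGroup P) (_ : Module A K) (_ : Module A P)
      (i : K →ₗ[A] P) (p : P →ₗ[A] M), Module.Free A P ∧ Function.Injective i ∧
      Function.Surjective p ∧ Function.Exact i p :=
  let p : (M →₀ A) →ₗ[A] M := Finsupp.linearCombination A id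
  ⟨LinearMap.ker p, M →₀ A, inferInstance, inferInstance, inferInstance, inferInstance,
    (LinearMap.ker p).subtype, p, inferInstance, Subtype.val_injective,
    Finsupp.linearCombination_id_surjective A M, LinearMap.exact_subtype_ker_map p⟩

/-- Dimension shifting along a direct sum of free presentations reduces to extending homomorphisms,
which is done componentwise. Infinite sums are needed because the torsion modules met later need not
be finitely generated. -/
theorem ExtVanishes.finsupp (X : Type u) {k : ℕ} (h : ExtVanishes A M₁ N k) :
    ExtVanishes A (X →₀ M₁) N k := by
  induction k generalizing M₁ with
  | zero =>
    rw [extVanishes_zero_iff] at h ⊢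
    intro g
    ext x m
    simpa using LinearMap.congr_fun (h (g ∘ₗ Finsupp.lsingle x)) m
  | succ k ih =>
    obtain ⟨K, P, _, _, _, _, i, p, hP, hi, hp, hip⟩ := exists_free_presentation A M₁
    let i' : (X →₀ K) →ₗ[A] (X →₀ P) := Finsupp.mapRange.linearMap i
    let p' : (X →₀ P) →ₗ[A] (X →₀ M₁) := Finsupp.mapRange.linearMap p
    have hi' : Function.Injective i' := Finsupp.mapRange_injective i (map_zero i) hi
    have hp' : Function.Surjective p' := Finsupp.mapRange_surjective p (map_zero p) hp
    have hip' : Function.Exact i' p' := by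
      intro y
      constructor
      · intro hy
        have hy' : ∀ x, ∃ z, i z = y x := fun x =>
          (hip (y x)).1 (by simpa [p'] using DFunLike.congr_fun hy x)
        choose z hz using hy'
        refine ⟨Finsupp.onFinset y.support z fun x hx => ?_, ?_⟩
        · rw [Finsupp.mem_support_iff, ← hz]
          exact fun h0 => hx (hi (h0.trans (map_zero i).symm))
        · ext1 x
          simp [i', hz]
      · rintro ⟨z, rfl⟩
        ext1 x
        simp [i', p', hip.apply_apply_eq_zero]
    rcases Nat.eq_zero_or_pos k with rfl | hk
    · refine ExtVanishes.right_one hi' hp' hip' (fun g => ?_) (ExtVanishes.of_projective one_pos)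
      choose g' hg' using fun x =>
        exists_extension_of_extVanishes_one hi hp hip h (g ∘ₗ Finsupp.lsingle x)
      refine ⟨Finsupp.lsum ℕ g', ?_⟩
      refine Finsupp.lhom_ext' fun x => ?_
      ext1 m
      simpa [i'] using LinearMap.congr_fun (hg' x) m
    · exact ExtVanishes.right hi' hp' hip'
        (ih (ExtVanishes.left hi hp hip (ExtVanishes.of_projective hk) h)) (ExtVanishes.of_projective k.succ_pos)

end ExtVanishing

/-! ### Corner rings `fAf` and the functor `M ↦ fM` -/

section Corner

variable {Γ A : Type u} [Ring Γ] [Ring A]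

/-- A non-unital ring homomorphism identifying `Γ` with the corner `fAf`, where `f = φ 1`. -/
structure IsCornerEmbedding (φ : Γ →ₙ+* A) : Prop where
  injective : Function.Injective φ
  exists_eq : ∀ x : A, ∃ γ, φ γ = φ 1 * x * φ 1

variable {φ : Γ →ₙ+* A}

theorem map_one_mul_map (φ : Γ →ₙ+* A) (γ : Γ) : φ 1 * φ γ = φ γ := by
  rw [← map_mul, one_mul]

theorem map_mul_map_one (φ : Γ →ₙ+* A) (γ : Γ) : φ γ * φ 1 = φ γ := by
  rw [← map_mul, mul_one]

namespace IsCornerEmbedding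

variable (hφ : IsCornerEmbedding φ)

/-- The additive map `x ↦ fxf` with values in the corner. -/
noncomputable def compress : A →+ Γ where
  toFun x := (hφ.exists_eq x).choose
  map_zero' := hφ.injective (by rw [(hφ.exists_eq 0).choose_spec]; simp)
  map_add' x y := hφ.injective (by
    rw [map_add, (hφ.exists_eq (x + y)).choose_spec, (hφ.exists_eq x).choose_spec,
      (hφ.exists_eq y).choose_spec]
    noncomm_ring)

theorem map_compress (x : A) : φ (hφ.compress x) = φ 1 * x * φ 1 := (hφ.exists_eq x).choose_spec

theorem compress_map (γ : Γ) : hφ.compress (φ γ) = γ :=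
  hφ.injective (by rw [map_compress, map_one_mul_map, map_mul_map_one])

theorem compress_map_mul (γ : Γ) (x : A) : hφ.compress (φ γ * x) = γ * hφ.compress x :=
  hφ.injective (by
    rw [map_mul φ, map_compress, map_compress]
    simp only [← mul_assoc, map_one_mul_map, map_mul_map_one])

end IsCornerEmbedding

variable {M N M₁ M₂ M₃ : Type u} [AddCommGroup M] [AddCommGroup N] [AddCommGroup M₁]
  [AddCommGroup M₂] [AddCommGroup M₃] [Module A M] [Module A N] [Module A M₁] [Module A M₂]
  [Module A M₃]

/-- The elements of `M` fixed by the idempotent `φ 1`. -/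
def cornerSubgroup (φ : Γ →ₙ+* A) (M : Type u) [AddCommGroup M] [Module A M] : AddSubgroup M where
  carrier := {m | φ 1 • m = m}
  zero_mem' := smul_zero _
  add_mem' {x y} hx hy := by
    change φ 1 • (x + y) = x + y
    rw [smul_add, show φ 1 • x = x from hx, show φ 1 • y = y from hy]
  neg_mem' {x} hx := by
    change φ 1 • (-x) = -x
    rw [smul_neg, show φ 1 • x = x from hx]

/-- The `Γ`-module `fM`, where `f = φ 1`. -/
def CornerModule (φ : Γ →ₙ+* A) (M : Type u) [AddCommGroup M] [Module A M] : Type u :=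
  cornerSubgroup φ M

namespace CornerModule

instance : AddCommGroup (CornerModule φ M) :=
  inferInstanceAs (AddCommGroup (cornerSubgroup φ M))

/-- The inclusion of `fM` into `M`. -/
def val : CornerModule φ M →+ M := (cornerSubgroup φ M).subtype

theorem val_injective : Function.Injective (val : CornerModule φ M → M) := Subtype.val_injective

@[simp] theorem map_one_smul_val (m : CornerModule φ M) : φ 1 • val m = val m := m.2

/-- An element fixed by `φ 1`, as an element of the corner module. -/
def mk (m : M) (hm : φ 1 • m = m) : CornerModule φ M := ⟨m, hm⟩

@[simp] theorem val_mk (m : M) (hm : φ 1 • m = m) : val (mk (φ := φ) m hm) = m := rfl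

instance : SMul Γ (CornerModule φ M) where
  smul γ m := mk (φ γ • val m) (by rw [smul_smul, map_one_mul_map])

@[simp] theorem val_smul (γ : Γ) (m : CornerModule φ M) : val (γ • m) = φ γ • val m := rfl

instance : Module Γ (CornerModule φ M) where
  one_smul m := val_injective (by simp)
  mul_smul x y m := val_injective (by simp [mul_smul])
  smul_zero x := val_injective (by simp)
  smul_add x m n := val_injective (by simp)
  add_smul x y m := val_injective (by simp [add_smul])
  zero_smul m := val_injective (by simp)

/-- The element `fm` of `fM`. -/
def proj (φ : Γ →ₙ+* A) (m : M) : CornerModule φ M :=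
  mk (φ 1 • m) (by rw [smul_smul, map_one_mul_map])

@[simp] theorem val_proj (m : M) : val (proj φ m) = φ 1 • m := rfl

/-- The restriction of a linear map to corner modules. -/
def map (φ : Γ →ₙ+* A) (g : M →ₗ[A] N) : CornerModule φ M →ₗ[Γ] CornerModule φ N where
  toFun m := mk (g (val m)) (by rw [← map_smul, map_one_smul_val])
  map_add' m n := val_injective (by simp)
  map_smul' γ m := val_injective (by simp)

@[simp] theorem val_map (g : M →ₗ[A] N) (m : CornerModule φ M) : val (map φ g m) = g (val m) := rfl

theorem map_injective {g : M →ₗ[A] N} (hg : Function.Injective g) :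
    Function.Injective (map φ g) := fun _ _ h =>
  val_injective (hg (congrArg val h))

theorem map_exact {i : M₁ →ₗ[A] M₂} {p : M₂ →ₗ[A] M₃} (hi : Function.Injective i)
    (h : Function.Exact i p) : Function.Exact (map φ i) (map φ p) := fun m => by
  constructor
  · intro hm
    obtain ⟨x, hx⟩ := (h (val m)).1 (by simpa using congrArg val hm)
    exact ⟨mk x (hi (by rw [map_smul, hx, map_one_smul_val])), val_injective (by simp [hx])⟩
  · rintro ⟨x, rfl⟩
    exact val_injective (by simp [h.apply_apply_eq_zero])

end CornerModule

open CornerModule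

/-- `M` is generated by `fM`. -/
def IsCornerGenerated (φ : Γ →ₙ+* A) (M : Type u) [AddCommGroup M] [Module A M] : Prop :=
  Submodule.span A (Set.range (val : CornerModule φ M → M)) = ⊤

/-- `M` is annihilated by `f`. -/
def IsCornerTorsion (φ : Γ →ₙ+* A) (M : Type u) [AddCommGroup M] [Module A M] : Prop :=
  ∀ m : M, φ 1 • m = 0

theorem IsCornerGenerated.hom_ext (hM : IsCornerGenerated φ M) {g g' : M →ₗ[A] N}
    (h : map φ g = map φ g') : g = g' :=
  LinearMap.ext_on hM (by
    rintro _ ⟨m, rfl⟩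
    exact congrArg val (LinearMap.congr_fun h m))

theorem IsCornerTorsion.cornerModule_subsingleton (hM : IsCornerTorsion φ M) :
    Subsingleton (CornerModule φ M) :=
  subsingleton_of_forall_eq 0 fun m => val_injective (by
    rw [← map_one_smul_val m, hM, map_zero])

theorem IsCornerTorsion.of_subsingleton (h : Subsingleton (CornerModule φ M)) :
    IsCornerTorsion φ M := fun m => by
  simpa using congrArg val (Subsingleton.elim (proj φ m) 0)

theorem IsCornerGenerated.hom_eq_zero (hM : IsCornerGenerated φ M) (hN : IsCornerTorsion φ N)
    (g : M →ₗ[A] N) : g = 0 :=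
  hM.hom_ext (by
    have := hN.cornerModule_subsingleton
    exact Subsingleton.elim _ _)

theorem IsCornerGenerated.of_surjective (hM : IsCornerGenerated φ M) {g : M →ₗ[A] N}
    (hg : Function.Surjective g) : IsCornerGenerated φ N := by
  rw [IsCornerGenerated, eq_top_iff, ← LinearMap.range_eq_top.2 hg, LinearMap.range_eq_map, ← hM,
    Submodule.map_span, Submodule.span_le]
  rintro _ ⟨_, ⟨m, rfl⟩, rfl⟩
  exact Submodule.subset_span ⟨map φ g m, rfl⟩

/-- Maps into the corner of `N` extend along projective modules generated by their corner. -/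
theorem exists_map_eq_of_projective (hφ : IsCornerEmbedding φ) [Module.Projective A M]
    (hM : IsCornerGenerated φ M) (h : CornerModule φ M →ₗ[Γ] CornerModule φ N) :
    ∃ g : M →ₗ[A] N, map φ g = h := by
  let c : (CornerModule φ M →₀ A) →ₗ[A] M := Finsupp.linearCombination A val
  have hc : Function.Surjective c := by
    rw [← LinearMap.range_eq_top, Finsupp.range_linearCombination]
    exact hM
  obtain ⟨σ, hσ⟩ := Module.projective_lifting_property c LinearMap.id hc
  refine ⟨Finsupp.linearCombination A (fun q => val (h q)) ∘ₗ σ, ?_⟩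
  ext m
  have key : ∀ (s : CornerModule φ M →₀ A),
      φ 1 • Finsupp.linearCombination A (fun q => val (h q)) s =
        val (h (proj φ (c s))) := by
    intro s
    have e1 : ∀ q : CornerModule φ M, ∀ a : A, proj φ (a • val q) = hφ.compress a • q := fun q a =>
      val_injective (by
        rw [val_proj, val_smul, hφ.map_compress, mul_smul, map_one_smul_val, mul_smul])
    have e2 : ∀ x y : M, proj φ (x + y) = proj φ x + proj φ y := fun x y =>
      val_injective (by simp)
    induction s using Finsupp.induction_linear with
    | zero =>
      have : proj φ (0 : M) = 0 := val_injective (by simp)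
      simp [this]
    | add s t hs ht => simp only [map_add, smul_add, hs, ht, e2]
    | single q a =>
      simp only [c, Finsupp.linearCombination_single, e1, map_smul, val_smul, hφ.map_compress,
        mul_smul, map_one_smul_val]
  apply val_injective
  have h1 := key (σ (val m))
  rw [← map_smul, ← map_smul, map_one_smul_val] at h1
  have h2 : c (σ (val m)) = val m := LinearMap.congr_fun hσ (val m)
  rw [val_map, LinearMap.comp_apply, h1, h2]
  congr 2
  exact val_injective (by simp)

/-- A splitting of the map from the free `A`-module on `fM` becomes a splitting over `Γ` after its
coefficients are compressed by `x ↦ fxf`. -/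
theorem cornerModule_projective (hφ : IsCornerEmbedding φ) [Module.Projective A M]
    (hM : IsCornerGenerated φ M) : Module.Projective Γ (CornerModule φ M) := by
  let c : (CornerModule φ M →₀ A) →ₗ[A] M := Finsupp.linearCombination A val
  have hc : Function.Surjective c := by
    rw [← LinearMap.range_eq_top, Finsupp.range_linearCombination]
    exact hM
  obtain ⟨σ, hσ⟩ := Module.projective_lifting_property c LinearMap.id hc
  let s : CornerModule φ M →ₗ[Γ] (CornerModule φ M →₀ Γ) :=
    { toFun := fun m => (σ (val m)).mapRange hφ.compress (map_zero _)
      map_add' := fun m n => by ext q; simp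
      map_smul' := fun γ m => by ext q; simp [hφ.compress_map_mul] }
  refine Module.projective_def.2 ⟨s, fun m => val_injective ?_⟩
  have key : ∀ t : CornerModule φ M →₀ A, val (Finsupp.linearCombination Γ id
      (t.mapRange hφ.compress (map_zero _))) = φ 1 • c t := by
    intro t
    induction t using Finsupp.induction_linear with
    | zero => simp
    | add t t' ht ht' =>
      rw [Finsupp.mapRange_add (map_add _), map_add, map_add, ht, ht', map_add, smul_add]
    | single q a => simp [c, hφ.map_compress, mul_smul]
  have h2 : c (σ (val m)) = val m := LinearMap.congr_fun hσ (val m)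
  change val (Finsupp.linearCombination Γ id ((σ (val m)).mapRange hφ.compress (map_zero _))) = _
  rw [key, h2, map_one_smul_val]

end Corner

/-! ### Projective covers of corners; orthogonality to corner torsion modules -/

section Corner

variable {Γ A : Type u} [Ring Γ] [Ring A] {φ : Γ →ₙ+* A}
variable {M N M₁ M₂ M₃ : Type u} [AddCommGroup M] [AddCommGroup N] [AddCommGroup M₁]
  [AddCommGroup M₂] [AddCommGroup M₃] [Module A M] [Module A N] [Module A M₁] [Module A M₂]
  [Module A M₃]

open CornerModule

/-- The condition `hs₂` makes `q ↦ s q` define an idempotent endomorphism `ε` of the free `A`-module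
on `fM`, and `Q` is its range. It is projective as a direct summand, and it is generated by its
corner because the coefficients of `s q` lie in `fAf`. If `s` is compatible with relations, nothing
in `fQ` is lost under `p`. -/
theorem exists_corner_cover_of_section (hφ : IsCornerEmbedding φ)
    (s : CornerModule φ M → (CornerModule φ M →₀ Γ))
    (hs₁ : ∀ q, Finsupp.linearCombination Γ id (s q) = q)
    (hs₂ : ∀ q, Finsupp.linearCombination Γ s (s q) = s q) :
    ∃ (Q : Type u) (_ : AddCommGroup Q) (_ : Module A Q) (p : Q →ₗ[A] M),
      Module.Projective A Q ∧ IsCornerGenerated φ Q ∧ Function.Surjective (map φ p) ∧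
      ((∀ t, Finsupp.linearCombination Γ id t = 0 → Finsupp.linearCombination Γ s t = 0) →
        Function.Injective (map φ p)) := by
  let j : (CornerModule φ M →₀ Γ) →+ (CornerModule φ M →₀ A) :=
    Finsupp.mapRange.addMonoidHom (φ : Γ →+ A)
  have hj : ∀ γ t, j (γ • t) = φ γ • j t := fun γ t => by
    ext q; simp [j]
  have hj1 : ∀ t, φ 1 • j t = j t := fun t => by rw [← hj, one_smul]
  let ε : (CornerModule φ M →₀ A) →ₗ[A] (CornerModule φ M →₀ A) :=
    Finsupp.linearCombination A (fun q => j (s q))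
  let P : (CornerModule φ M →₀ A) →ₗ[A] M := Finsupp.linearCombination A val
  have hεj : ∀ t, ε (j t) = j (Finsupp.linearCombination Γ s t) := by
    intro t
    induction t using Finsupp.induction_linear with
    | zero => simp
    | add t t' ht ht' => simp only [map_add, ht, ht']
    | single q γ =>
      rw [Finsupp.linearCombination_single, hj]
      simp [j, ε]
  have hPj : ∀ t, P (j t) = val (Finsupp.linearCombination Γ id t) := by
    intro t
    induction t using Finsupp.induction_linear with
    | zero => simp
    | add t t' ht ht' => simp only [map_add, ht, ht']
    | single q γ => simp [j, P]
  have hεs : ∀ q, ε (Finsupp.single q 1) = j (s q) := fun q => by simp [ε]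
  have hε : ε ∘ₗ ε = ε := by
    refine Finsupp.lhom_ext' fun q => LinearMap.ext_ring ?_
    simp only [LinearMap.comp_apply, Finsupp.lsingle_apply, hεs, hεj, hs₂]
  have hPε : P ∘ₗ ε = P := by
    refine Finsupp.lhom_ext' fun q => LinearMap.ext_ring ?_
    simp only [LinearMap.comp_apply, Finsupp.lsingle_apply, hεs, hPj, hs₁]
    simp [P]
  have hεr : ∀ x : LinearMap.range ε, ε x = x := by
    rintro ⟨_, y, rfl⟩
    exact LinearMap.congr_fun hε y
  refine ⟨LinearMap.range ε, inferInstance, inferInstance, P ∘ₗ (LinearMap.range ε).subtype,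
    ?_, ?_, ?_, ?_⟩
  · exact Module.Projective.of_split (LinearMap.range ε).subtype ε.rangeRestrict
      (LinearMap.ext fun x => Subtype.ext (hεr x))
  · rw [IsCornerGenerated, eq_top_iff]
    refine (LinearMap.range_eq_top.2 ε.surjective_rangeRestrict).ge.trans ?_
    rw [LinearMap.range_eq_map ε.rangeRestrict, ← Finsupp.basisSingleOne.span_eq, Submodule.map_span,
      Submodule.span_le]
    rintro _ ⟨_, ⟨q, rfl⟩, rfl⟩
    refine Submodule.subset_span ⟨mk (ε.rangeRestrict (Finsupp.single q 1)) (Subtype.ext ?_), ?_⟩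
    · change φ 1 • ε _ = ε _
      rw [hεs, hj1]
    · simp
  · intro q
    refine ⟨mk (ε.rangeRestrict (Finsupp.single q 1)) (Subtype.ext ?_), val_injective ?_⟩
    · change φ 1 • ε _ = ε _
      rw [hεs, hj1]
    · change P (ε _) = _
      rw [hεs, hPj, hs₁]
  · intro hlin
    rw [injective_iff_map_eq_zero]
    intro x hx
    let y : CornerModule φ M →₀ A := (val x : LinearMap.range ε)
    have hy1 : φ 1 • y = y := congrArg Subtype.val (map_one_smul_val x)
    have hy2 : ε y = y := hεr _
    have hy3 : P y = 0 := congrArg val hx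
    have key : ∀ y, ε (j (y.mapRange hφ.compress (map_zero _))) = φ 1 • ε y := by
      intro y
      induction y using Finsupp.induction_linear with
      | zero => simp
      | add t t' ht ht' =>
        rw [Finsupp.mapRange_add (map_add _), map_add, map_add, ht, ht', map_add, smul_add]
      | single q a =>
        have h1 : j ((Finsupp.single q a).mapRange hφ.compress (map_zero _)) =
            Finsupp.single q (φ 1 * a * φ 1) := by simp [j, hφ.map_compress]
        rw [h1]
        simp only [ε, Finsupp.linearCombination_single, mul_smul, hj1]
    have hy4 := key y
    rw [hy2, hy1] at hy4
    rw [← hy4, ← LinearMap.comp_apply, hPε, hPj] at hy3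
    rw [hεj, hlin _ (val_injective (by rw [hy3, map_zero])), map_zero] at hy4
    exact val_injective (Subtype.ext hy4.symm)

/-- Every module is covered, up to a corner torsion cokernel, by a projective module generated by
its corner; the kernel is corner torsion if the corner of the given module is projective. -/
theorem exists_corner_cover (hφ : IsCornerEmbedding φ) (M : Type u) [AddCommGroup M] [Module A M] :
    ∃ (Q : Type u) (_ : AddCommGroup Q) (_ : Module A Q) (p : Q →ₗ[A] M),
      Module.Projective A Q ∧ IsCornerGenerated φ Q ∧ Function.Surjective (map φ p) ∧
      (Module.Projective Γ (CornerModule φ M) → Function.Injective (map φ p)) := by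
  -- If `fM` is projective, a linear section gives `Q` with `fQ ≅ fM`. Otherwise the tautological
  -- section gives a direct sum of copies of `Af`.
  by_cases h : Module.Projective Γ (CornerModule φ M)
  · obtain ⟨s, hs⟩ := Module.projective_def.1 h
    have key : ∀ t, Finsupp.linearCombination Γ s t = s (Finsupp.linearCombination Γ id t) :=
      fun t => by simp [Finsupp.linearCombination_apply, Finsupp.sum, map_sum]
    obtain ⟨Q, _, _, p, h1, h2, h3, h4⟩ := exists_corner_cover_of_section hφ s hs
      (fun q => by rw [key, hs])
    exact ⟨Q, _, _, p, h1, h2, h3, fun _ => h4 fun t ht => by rw [key, ht, map_zero]⟩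
  · obtain ⟨Q, _, _, p, h1, h2, h3, h4⟩ := exists_corner_cover_of_section (M := M) hφ
      (fun q => Finsupp.single q 1) (fun q => by simp) (fun q => by simp)
    exact ⟨Q, _, _, p, h1, h2, h3, fun h' => absurd h' h⟩

/-- The module `M` has no extensions, in any degree, by corner torsion modules. -/
def IsCornerOrthogonal (φ : Γ →ₙ+* A) (M : Type u) [AddCommGroup M] [Module A M] : Prop :=
  ∀ (L : Type u) [AddCommGroup L] [Module A L], IsCornerTorsion φ L → ∀ k, ExtVanishes A M L k

theorem IsCornerGenerated.isCornerOrthogonal [Module.Projective A M] (hM : IsCornerGenerated φ M) :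
    IsCornerOrthogonal φ M := fun L _ _ hL k => by
  rcases Nat.eq_zero_or_pos k with rfl | hk
  · exact extVanishes_zero_iff.2 (hM.hom_eq_zero hL)
  · exact ExtVanishes.of_projective hk

theorem isCornerTorsion_quotient {p : M →ₗ[A] N} (hp : Function.Surjective (map φ p)) :
    IsCornerTorsion φ (N ⧸ LinearMap.range p) := fun x => by
  obtain ⟨n, rfl⟩ := Submodule.Quotient.mk_surjective _ x
  obtain ⟨m, hm⟩ := hp (proj φ n)
  rw [← Submodule.Quotient.mk_smul, Submodule.Quotient.mk_eq_zero]
  exact ⟨val m, congrArg val hm⟩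

/-- The quotient of `M` by the submodule generated by `fM` is corner torsion, so orthogonality in
degree zero kills the projection onto it. -/
theorem IsCornerOrthogonal.isCornerGenerated (hM : IsCornerOrthogonal φ M) :
    IsCornerGenerated φ M := by
  have : IsCornerTorsion φ (M ⧸ Submodule.span A (Set.range (val : CornerModule φ M → M))) := by
    intro x
    obtain ⟨n, rfl⟩ := Submodule.Quotient.mk_surjective _ x
    rw [← Submodule.Quotient.mk_smul, Submodule.Quotient.mk_eq_zero]
    exact Submodule.subset_span ⟨proj φ n, rfl⟩
  have h := extVanishes_zero_iff.1 (hM _ this 0) (Submodule.mkQ _)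
  rw [IsCornerGenerated, ← Submodule.ker_mkQ (Submodule.span A _), h, LinearMap.ker_zero]

theorem IsCornerOrthogonal.kernel {i : M₁ →ₗ[A] M₂} {p : M₂ →ₗ[A] M₃} (hi : Function.Injective i)
    (hp : Function.Surjective p) (hip : Function.Exact i p) (h₂ : IsCornerOrthogonal φ M₂)
    (h₃ : IsCornerOrthogonal φ M₃) : IsCornerOrthogonal φ M₁ := fun L _ _ hL k =>
  ExtVanishes.left hi hp hip (h₂ L hL k) (h₃ L hL (k + 1))

theorem IsCornerOrthogonal.cokernel {i : M₁ →ₗ[A] M₂} {p : M₂ →ₗ[A] M₃}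
    (hi : Function.Injective i) (hp : Function.Surjective p) (hip : Function.Exact i p)
    (h₁ : IsCornerOrthogonal φ M₁) (h₂ : IsCornerOrthogonal φ M₂) : IsCornerOrthogonal φ M₃ :=
  by
  intro L _ _ hL k
  rcases k with _ | k
  · exact extVanishes_zero_iff.2 ((h₂.isCornerGenerated.of_surjective hp).hom_eq_zero hL)
  · exact ExtVanishes.right hi hp hip (h₁ L hL k) (h₂ L hL (k + 1))

theorem IsCornerGenerated.surjective_of_map_surjective (hM : IsCornerGenerated φ M)
    {p : N →ₗ[A] M} (hp : Function.Surjective (map φ p)) : Function.Surjective p := by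
  rw [← LinearMap.range_eq_top, eq_top_iff, ← hM, Submodule.span_le]
  rintro _ ⟨m, rfl⟩
  obtain ⟨n, rfl⟩ := hp m
  exact ⟨val n, rfl⟩

/-- For modules orthogonal to the corner torsion modules, vanishing of extensions can be tested
over the corner ring. -/
theorem IsCornerOrthogonal.extVanishes (hφ : IsCornerEmbedding φ) {k : ℕ} (hk : 0 < k)
    (hM : IsCornerOrthogonal φ M)
    (h : ExtVanishes Γ (CornerModule φ M) (CornerModule φ N) k) : ExtVanishes A M N k := by
  induction k, hk using Nat.le_induction generalizing M with
  | base =>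
    obtain ⟨Q, _, _, p, hQ, hQg, hpf, -⟩ := exists_corner_cover hφ M
    have hp := hM.isCornerGenerated.surjective_of_map_surjective hpf
    have hi : Function.Injective (LinearMap.ker p).subtype := Subtype.val_injective
    have hip := LinearMap.exact_subtype_ker_map p
    -- The kernel is again orthogonal, hence generated by its corner. Maps out of it are therefore
    -- determined on corners, and dimension shifting can continue.
    have hK := IsCornerOrthogonal.kernel hi hp hip hQg.isCornerOrthogonal hM
    refine ExtVanishes.right_one hi hp hip (fun g => ?_) (ExtVanishes.of_projective one_pos)
    obtain ⟨g', hg'⟩ := exists_extension_of_extVanishes_one (map_injective hi) hpf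
      (map_exact hi hip) h (map φ g)
    obtain ⟨g'', rfl⟩ := exists_map_eq_of_projective hφ hQg g'
    exact ⟨g'', hK.isCornerGenerated.hom_ext hg'⟩
  | succ k hk ih =>
    obtain ⟨Q, _, _, p, hQ, hQg, hpf, -⟩ := exists_corner_cover hφ M
    have hp := hM.isCornerGenerated.surjective_of_map_surjective hpf
    have hi : Function.Injective (LinearMap.ker p).subtype := Subtype.val_injective
    have hip := LinearMap.exact_subtype_ker_map p
    have hK := IsCornerOrthogonal.kernel hi hp hip hQg.isCornerOrthogonal hM
    have := cornerModule_projective hφ hQg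
    exact ExtVanishes.right hi hp hip (ih hK (ExtVanishes.left (map_injective hi) hpf
      (map_exact hi hip) (ExtVanishes.of_projective hk) h))
      (ExtVanishes.of_projective k.succ_pos)

end Corner

/-! ### The dichotomy: orthogonality or a nonzero extension of high degree -/

section Corner

variable {Γ A : Type u} [Ring Γ] [Ring A] {φ : Γ →ₙ+* A}

open CornerModule

/-- The bound must drop even from `1` to `0`, which for an arbitrary cover of a projective module
would fail; `hinj` makes the kernel zero in that case. -/
theorem hasProjectiveDimensionLT_kernel {K Q M : Type u} [AddCommGroup K] [AddCommGroup Q]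
    [AddCommGroup M] [Module A K] [Module A Q] [Module A M] {i : K →ₗ[A] Q} {p : Q →ₗ[A] M}
    (hi : Function.Injective i) (hp : Function.Surjective p) (hip : Function.Exact i p)
    [Module.Projective A Q] (hinj : Module.Projective A M → Function.Injective p) {d : ℕ}
    (h : HasProjectiveDimensionLT (ModuleCat.of A M) (d + 1)) :
    HasProjectiveDimensionLT (ModuleCat.of A K) d := by
  have hQ : Projective (ModuleCat.of A Q) := (IsProjective.iff_projective (R := A) Q).1 inferInstance
  rcases d with _ | d
  · have hM : Projective (ModuleCat.of A M) := projective_iff_hasProjectiveDimensionLT_one |>.2 h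
    have := hinj ((IsProjective.iff_projective (R := A) M).2 hM)
    have : Subsingleton K := subsingleton_of_forall_eq 0 fun x => hi (this (by
      rw [hip.apply_apply_eq_zero, map_zero, map_zero]))
    exact (ModuleCat.isZero_of_subsingleton (ModuleCat.of A K)).hasProjectiveDimensionLT_zero
  · exact (moduleCat_shortExact hi hp hip).hasProjectiveDimensionLT_X₁ (d + 1)
      (hasProjectiveDimensionLT_of_ge _ 1 _ (by omega)) h

/-- Suppose that `Ext^l(-, N)` is the highest extension functor not vanishing on the corner torsion
modules, and that it vanishes on none of them but zero. If `M` has no extensions by `N` over the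
corner ring, then `M` is orthogonal to the corner torsion modules or has an extension by `N` of
degree at least `l`. -/
theorem isCornerOrthogonal_or_exists_not_extVanishes (hφ : IsCornerEmbedding φ)
    {N : Type u} [AddCommGroup N] [Module A N] {l : ℕ} (hl : 0 < l ∨ IsCornerTorsion φ N)
    (hgt : ∀ (L : Type u) [AddCommGroup L] [Module A L], IsCornerTorsion φ L →
      ∀ t, l < t → ExtVanishes A L N t)
    (hne : ∀ (L : Type u) [AddCommGroup L] [Module A L], IsCornerTorsion φ L → Nontrivial L →
      ¬ ExtVanishes A L N l)
    (d : ℕ) {M : Type u} [AddCommGroup M] [Module A M]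
    (hd : HasProjectiveDimensionLT (ModuleCat.of Γ (CornerModule φ M)) d)
    (hext : ∀ k, 0 < k → ExtVanishes Γ (CornerModule φ M) (CornerModule φ N) k)
    (hhom : ∀ h : CornerModule φ M →ₗ[Γ] CornerModule φ N, ∃ g : M →ₗ[A] N, map φ g = h) :
    IsCornerOrthogonal φ M ∨ ∃ t, l ≤ t ∧ ¬ ExtVanishes A M N t := by
  induction d generalizing M with
  | zero =>
    have h0 : Subsingleton (CornerModule φ M) :=
      ModuleCat.subsingleton_of_isZero (isZero_of_hasProjectiveDimensionLT_zero
        (ModuleCat.of Γ (CornerModule φ M)))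
    rcases subsingleton_or_nontrivial M with h | h
    · exact Or.inl fun L _ _ _ k => ExtVanishes.of_subsingleton k
    · exact Or.inr ⟨l, le_rfl, hne M (IsCornerTorsion.of_subsingleton h0) h⟩
  | succ d ih =>
    obtain ⟨Q, _, _, p, hQ, hQg, hpf, hinj⟩ := exists_corner_cover hφ M
    have := cornerModule_projective hφ hQg
    let i := (LinearMap.ker p).subtype
    have hi : Function.Injective i := Subtype.val_injective
    have hip : Function.Exact i p := LinearMap.exact_subtype_ker_map p
    have hp' := p.surjective_rangeRestrict
    have hip' : Function.Exact i p.rangeRestrict := fun x =>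
      (Subtype.ext_iff (a1 := p.rangeRestrict x) (a2 := 0)).trans (hip x)
    let j := (LinearMap.range p).subtype
    have hj : Function.Injective j := Subtype.val_injective
    have hq := Submodule.mkQ_surjective (LinearMap.range p)
    have hjq : Function.Exact j (Submodule.mkQ (LinearMap.range p)) :=
      LinearMap.exact_subtype_mkQ _
    have hL := isCornerTorsion_quotient hpf
    have hRg : IsCornerGenerated φ (LinearMap.range p) := hQg.of_surjective hp'
    have hRM : Function.Bijective (map φ j) := by
      refine ⟨map_injective hj, fun m => ?_⟩
      obtain ⟨x, rfl⟩ := hpf m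
      exact ⟨map φ p.rangeRestrict x, rfl⟩
    -- The kernel `K` of `p` inherits the hypotheses: its corner is a syzygy of `fM`, and `Ext¹(fM,
    -- fN) = 0` extends maps `fK → fN` to `fQ`, where they lift to `Q → N`.
    have hK := ih (hasProjectiveDimensionLT_kernel (map_injective hi) hpf (map_exact hi hip) hinj hd)
      (fun k hk => ExtVanishes.left (map_injective hi) hpf (map_exact hi hip)
        (ExtVanishes.of_projective hk) (hext (k + 1) k.succ_pos))
      (fun h => by
        obtain ⟨g', rfl⟩ := exists_extension_of_extVanishes_one (map_injective hi) hpf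
          (map_exact hi hip) (hext 1 one_pos) h
        obtain ⟨g, rfl⟩ := exists_map_eq_of_projective hφ hQg g'
        exact ⟨g ∘ₗ i, rfl⟩)
    rcases hK with hK | ⟨t, hlt, ht⟩
    · have hR : IsCornerOrthogonal φ (LinearMap.range p) :=
        IsCornerOrthogonal.cokernel hi hp' hip' hK hQg.isCornerOrthogonal
      rcases subsingleton_or_nontrivial (M ⧸ LinearMap.range p) with h | h
      · refine Or.inl fun L _ _ hLt k => ?_
        exact ExtVanishes.middle hj hq hjq (hR L hLt k) (ExtVanishes.of_subsingleton k)
      -- The torsion cokernel `L` of `p` is nonzero. With `R` the image of `p`, it suffices that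
      -- `Ext^l(L, N) → Ext^l(M, N)` is injective, that is, that the connecting map from
      -- `Ext^(l-1)(R, N)` vanishes. For `l = 1` this holds because maps `R → N` extend to `M` by
      -- `hhom`; for `l > 1`, because `Ext^(l-1)(R, N)` vanishes by comparison with `Γ`.
      · refine Or.inr ⟨l, le_rfl, fun hMl => hne _ hL h ?_⟩
        rcases l with _ | l
        · rw [extVanishes_zero_iff] at hMl ⊢
          exact fun g => LinearMap.ext fun x => by
            obtain ⟨m, rfl⟩ := hq x
            exact LinearMap.congr_fun (hMl (g ∘ₗ Submodule.mkQ _)) m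
        rcases Nat.eq_zero_or_pos l with rfl | hl'
        · refine ExtVanishes.right_one hj hq hjq (fun g => ?_) hMl
          obtain ⟨g', hg'⟩ := hhom (map φ g ∘ₗ (LinearEquiv.ofBijective _ hRM).symm.toLinearMap)
          refine ⟨g', hRg.hom_ext (LinearMap.ext fun x => ?_)⟩
          have := LinearMap.congr_fun hg' (map φ j x)
          simp only [LinearMap.comp_apply, LinearEquiv.coe_coe] at this
          rw [← LinearEquiv.ofBijective_apply (hf := hRM), LinearEquiv.symm_apply_apply] at this
          exact this
        · exact ExtVanishes.right hj hq hjq (hR.extVanishes hφ hl'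
            ((hext l hl').congr (LinearEquiv.ofBijective _ hRM).symm)) hMl
    -- A nonzero class on the kernel moves up one degree to the image of `p`, and then to `M`, since
    -- `Ext^(t+2)` of the torsion cokernel by `N` is zero.
    · refine Or.inr ⟨t + 1, by omega, fun hM => ht ?_⟩
      have hR : ExtVanishes A (LinearMap.range p) N (t + 1) :=
        ExtVanishes.left hj hq hjq hM (hgt _ hL _ (by omega))
      refine ExtVanishes.left hi hp' hip' ?_ hR
      -- `Ext^t(Q, N)` must vanish for the shift; for `t = 0` this requires `N` to be corner
      -- torsion.
      rcases hl with hl | hN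
      · exact ExtVanishes.of_projective (by omega)
      · exact hQg.isCornerOrthogonal N hN t

end Corner

/-! ### Filtrations of corner torsion modules with layers built from one simple module -/

section Loewy

variable {A : Type u} [Ring A] {e : A} {S L L' : Type u} [AddCommGroup S] [Module A S]
  [AddCommGroup L] [Module A L] [AddCommGroup L'] [Module A L']

/-- The elements of `eAe` that annihilate `S`. -/
def cornerAnnihilator (e : A) (S : Type u) [AddCommGroup S] [Module A S] : Set A :=
  {x | e * x * e = x ∧ ∀ s : S, x • s = 0}

/-- Every element of `eAe` annihilates `S` or is left invertible in `eAe`. -/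
def IsCornerLocal (e : A) (S : Type u) [AddCommGroup S] [Module A S] : Prop :=
  ∀ x : A, e * x * e = x → (∀ s : S, x • s = 0) ∨ ∃ y, y * x = e

theorem mul_mem_cornerAnnihilator (he : e * e = e) {x : A}
    (hx : x ∈ cornerAnnihilator e S) (a : A) : e * a * x ∈ cornerAnnihilator e S := by
  obtain ⟨h1, h2⟩ := hx
  have h3 : x * e = x := by rw [← h1, mul_assoc _ e e, he]
  refine ⟨?_, fun s => by rw [mul_smul, h2, smul_zero]⟩
  simp only [← mul_assoc, he]
  rw [mul_assoc _ x e, h3]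

/-- If `a` kills `z ≠ 0`, then `eae` is not left invertible, so it annihilates `S` by locality,
hence kills `w`. Used in both directions, this shows that the annihilators of `z` and of a nonzero
element of `S` agree. -/
theorem smul_eq_zero_of_smul_eq_zero (he : e * e = e) (hloc : IsCornerLocal e S)
    (heL : ∀ z : L, e • z = z) (heL' : ∀ z : L', e • z = z) {z : L} {w : L'} (hz : z ≠ 0)
    (hw : ∀ x ∈ cornerAnnihilator e S, x • w = 0) {a : A} (ha : a • z = 0) : a • w = 0 := by
  have h1 : e * (e * a * e) * e = e * a * e := by
    simp only [← mul_assoc, he]; rw [mul_assoc _ e e, he]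
  have h2 : (e * a * e) • z = 0 := by rw [mul_smul, heL, mul_smul, ha, smul_zero]
  rcases hloc _ h1 with h | ⟨y, hy⟩
  · have := hw _ ⟨h1, h⟩
    rwa [mul_smul, heL', mul_smul, heL'] at this
  · exact absurd (by rw [← heL z, ← hy, mul_smul, h2, smul_zero]) hz

theorem nonempty_linearEquiv_span (he : e * e = e) (hloc : IsCornerLocal e S) [IsSimpleModule A S]
    (heS : ∀ s : S, e • s = s) (heL : ∀ z : L, e • z = z) {z : L} (hz : z ≠ 0)
    (hzm : ∀ x ∈ cornerAnnihilator e S, x • z = 0) :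
    Nonempty (Submodule.span A {z} ≃ₗ[A] S) := by
  have := IsSimpleModule.nontrivial A S
  obtain ⟨s, hs⟩ := exists_ne (0 : S)
  have hker : LinearMap.ker (LinearMap.toSpanSingleton A L z) =
      LinearMap.ker (LinearMap.toSpanSingleton A S s) := by
    ext a
    simp only [LinearMap.mem_ker, LinearMap.toSpanSingleton_apply]
    exact ⟨smul_eq_zero_of_smul_eq_zero he hloc heL heS hz fun x hx => hx.2 s,
      smul_eq_zero_of_smul_eq_zero he hloc heS heL hs hzm⟩
  rw [← LinearMap.range_toSpanSingleton]
  exact ⟨(LinearMap.quotKerEquivRange _).symm ≪≫ₗ (Submodule.quotEquivOfEq _ _ hker) ≪≫ₗ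
    LinearMap.quotKerEquivOfSurjective _ (IsSimpleModule.toSpanSingleton_surjective A hs)⟩

/-- Every nonzero cyclic submodule of `L` is isomorphic to `S`, so `L` is a direct sum of copies of
`S`. -/
theorem ExtVanishes.of_cornerAnnihilator_smul (he : e * e = e) (hloc : IsCornerLocal e S)
    [IsSimpleModule A S] (heS : ∀ s : S, e • s = s) (heL : ∀ z : L, e • z = z)
    (hm : ∀ x ∈ cornerAnnihilator e S, ∀ z : L, x • z = 0) {N : Type u} [AddCommGroup N]
    [Module A N] {k : ℕ} (h : ExtVanishes A S N k) : ExtVanishes A L N k := by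
  have hs : ∀ z : L, z ≠ 0 → IsSimpleModule A (Submodule.span A {z}) := fun z hz => by
    obtain ⟨f⟩ := nonempty_linearEquiv_span he hloc heS heL hz fun x hx => hm x hx z
    exact IsSimpleModule.congr f
  have : IsSemisimpleModule A L := by
    refine IsSemisimpleModule.of_sSup_simples_eq_top (eq_top_iff.2 fun z _ => ?_)
    by_cases hz : z = 0
    · rw [hz]; exact zero_mem _
    · exact (le_sSup (a := Submodule.span A {z}) (hs z hz)) (Submodule.mem_span_singleton_self z)
  have hiso : IsIsotypicOfType A L S := fun m hmS => by
    have := IsSimpleModule.nontrivial A m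
    obtain ⟨z, hz⟩ := exists_ne (0 : m)
    obtain ⟨f⟩ := nonempty_linearEquiv_span (L := m) he hloc heS
      (fun z => Subtype.ext (heL z)) hz fun x hx => Subtype.ext (hm x hx z)
    exact ⟨(LinearEquiv.ofTop _ (IsSimpleModule.span_singleton_eq_top A hz)).symm ≪≫ₗ f⟩
  obtain ⟨X, ⟨f⟩⟩ := hiso.linearEquiv_finsupp
  exact (h.finsupp X).congr f.symm

/-- Every product of `n` elements of `s` annihilates `L`. -/
def IsNilpotentOn (s : Set A) (n : ℕ) (L : Type u) [AddCommGroup L] [Module A L] : Prop :=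
  ∀ l : List A, l.length = n → (∀ x ∈ l, x ∈ s) → ∀ z : L, l.prod • z = 0

theorem ExtVanishes.of_isNilpotentOn (he : e * e = e) (hloc : IsCornerLocal e S)
    [IsSimpleModule A S] (heS : ∀ s : S, e • s = s) {N : Type u} [AddCommGroup N]
    [Module A N] {k : ℕ} (h : ExtVanishes A S N k) (n : ℕ) (heL : ∀ z : L, e • z = z)
    (hn : IsNilpotentOn (cornerAnnihilator e S) n L) : ExtVanishes A L N k := by
  induction n generalizing L with
  | zero =>
    have : Subsingleton L := subsingleton_of_forall_eq 0 fun z => by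
      simpa using hn [] rfl (by simp) z
    exact ExtVanishes.of_subsingleton k
  | succ n ih =>
    -- `U` is `𝔪L` for `𝔪 = cornerAnnihilator e S`. It is stable under `A`, not only under `eAe`,
    -- because `e` acts as the identity on `L`. The nilpotency index drops on `U`, and `𝔪` kills
    -- `L/U`.
    let U : Submodule A L :=
      { (AddSubgroup.closure
          {y : L | ∃ x ∈ cornerAnnihilator e S, ∃ z : L, y = x • z}).toAddSubmonoid with
        smul_mem' := by
          intro a y hy
          change y ∈ AddSubgroup.closure _ at hy
          change a • y ∈ AddSubgroup.closure _
          induction hy using AddSubgroup.closure_induction with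
          | mem y hy =>
            obtain ⟨x, hx, z, rfl⟩ := hy
            refine AddSubgroup.subset_closure ⟨e * a * x,
              mul_mem_cornerAnnihilator he hx a, z, ?_⟩
            rw [mul_assoc, mul_smul, heL, mul_smul]
          | zero => rw [smul_zero]; exact zero_mem _
          | add y z _ _ hy hz => rw [smul_add]; exact add_mem hy hz
          | neg y _ hy => rw [smul_neg]; exact neg_mem hy }
    have hU : ExtVanishes A U N k := by
      refine ih (fun z => Subtype.ext (heL z)) fun l hl hlm ⟨z, hz⟩ => Subtype.ext ?_
      change l.prod • z = 0
      change z ∈ AddSubgroup.closure _ at hz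
      induction hz using AddSubgroup.closure_induction with
      | mem y hy =>
        obtain ⟨x, hx, w, rfl⟩ := hy
        have := hn (l ++ [x]) (by simp [hl]) (by
          intro y hy
          rcases List.mem_append.1 hy with hy | hy
          · exact hlm y hy
          · rw [List.mem_singleton.1 hy]; exact hx) w
        simpa [mul_smul] using this
      | zero => rw [smul_zero]
      | add y z _ _ hy hz => rw [smul_add, hy, hz, add_zero]
      | neg y _ hy => rw [smul_neg, hy, neg_zero]
    have hQ : ExtVanishes A (L ⧸ U) N k := by
      refine ExtVanishes.of_cornerAnnihilator_smul he hloc heS (fun z => ?_) (fun x hx z => ?_) h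
      · obtain ⟨z, rfl⟩ := Submodule.Quotient.mk_surjective _ z
        rw [← Submodule.Quotient.mk_smul, heL]
      · obtain ⟨z, rfl⟩ := Submodule.Quotient.mk_surjective _ z
        rw [← Submodule.Quotient.mk_smul, Submodule.Quotient.mk_eq_zero]
        exact AddSubgroup.subset_closure ⟨x, hx, z, rfl⟩
    exact ExtVanishes.middle (i := U.subtype) (p := U.mkQ) Subtype.val_injective
      (Submodule.mkQ_surjective U) (LinearMap.exact_subtype_mkQ U) hU hQ

theorem exists_ne_zero_of_isNilpotentOn [Nontrivial L] {s : Set A} {n : ℕ}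
    (hn : IsNilpotentOn s n L) : ∃ z : L, z ≠ 0 ∧ ∀ x ∈ s, x • z = 0 := by
  induction n with
  | zero =>
    obtain ⟨z, hz⟩ := exists_ne (0 : L)
    exact absurd (by simpa using hn [] rfl (by simp) z) hz
  | succ n ih =>
    by_cases h : IsNilpotentOn s n L
    · exact ih h
    · simp only [IsNilpotentOn, not_forall] at h
      obtain ⟨l, hl, hls, z, hz⟩ := h
      refine ⟨l.prod • z, hz, fun x hx => ?_⟩
      have := hn (x :: l) (by simp [hl]) (by
        intro y hy
        rcases List.mem_cons.1 hy with rfl | hy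
        · exact hx
        · exact hls y hy) z
      simpa [mul_smul] using this

/-- `L` contains a copy of `S`, and `Ext^k(L, N) → Ext^k(S, N)` is surjective because `Ext^(k+1)`
vanishes on the quotient, which is again filtered by copies of `S`. -/
theorem not_extVanishes_of_isNilpotentOn (he : e * e = e) (hloc : IsCornerLocal e S)
    [IsSimpleModule A S] (heS : ∀ s : S, e • s = s) {N : Type u} [AddCommGroup N]
    [Module A N] {k : ℕ} (h : ¬ ExtVanishes A S N k) (h' : ExtVanishes A S N (k + 1)) {n : ℕ}
    [Nontrivial L] (heL : ∀ z : L, e • z = z)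
    (hn : IsNilpotentOn (cornerAnnihilator e S) n L) : ¬ ExtVanishes A L N k := fun hL => by
  obtain ⟨z, hz, hzm⟩ := exists_ne_zero_of_isNilpotentOn hn
  obtain ⟨f⟩ := nonempty_linearEquiv_span he hloc heS heL hz hzm
  refine h (ExtVanishes.congr (ExtVanishes.left (i := (Submodule.span A {z}).subtype)
    (p := Submodule.mkQ _) Subtype.val_injective (Submodule.mkQ_surjective _)
    (LinearMap.exact_subtype_mkQ _) hL (ExtVanishes.of_isNilpotentOn he hloc heS h' n
      (fun w => ?_) fun l hl hlm w => ?_)) f)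
  · obtain ⟨w, rfl⟩ := Submodule.Quotient.mk_surjective _ w
    rw [← Submodule.Quotient.mk_smul, heL]
  · obtain ⟨w, rfl⟩ := Submodule.Quotient.mk_surjective _ w
    rw [← Submodule.Quotient.mk_smul, hn l hl hlm, Submodule.Quotient.mk_zero]

end Loewy

/-! ### Simple systems: deleting one idempotent, and absence of loops -/

section SimpleSystem

open CornerModule

theorem ExtVanishes.of_subsingleton_right {A : Type u} [Ring A] {M N : Type u} [AddCommGroup M]
    [AddCommGroup N] [Module A M] [Module A N] [Subsingleton N] (k : ℕ) : ExtVanishes A M N k := by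
  refine subsingleton_of_forall_eq 0 fun x => ?_
  have h : 𝟙 (ModuleCat.of A N) = 0 :=
    (ModuleCat.isZero_of_subsingleton (ModuleCat.of A N)).eq_of_src _ _
  rw [← x.comp_mk₀_id, h]
  simp

/-- The corner rings of a system of idempotents `e i` obtained by deleting some of them are
realized by rings of finite global dimension. -/
def HasFiniteCorners {A : Type u} {ι : Type*} [Ring A] (I : Finset ι) (e : ι → A) : Prop :=
  ∀ C ⊆ I, ∃ (Γ : Type u) (_ : Ring Γ) (φ : Γ →ₙ+* A), IsCornerEmbedding φ ∧
    φ 1 = 1 - ∑ i ∈ C, e i ∧ ∃ d, ∀ M : ModuleCat.{u} Γ, HasProjectiveDimensionLT M d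

/-- A system of orthogonal local idempotents `e i`, for `i ∈ I`, with simple modules `S i` on which
`e i` acts as the identity, such that the elements of `(e i)A(e i)` annihilating `S i` are
nilpotent modulo the ideal generated by `1 - ∑ i ∈ I, e i`, and such that the corner rings
obtained by deleting some of the `e i` have finite global dimension. -/
structure IsSimpleSystem {A : Type u} {ι : Type*} [Ring A] (I : Finset ι) (e : ι → A) (S : ι → Type u)
    [∀ i, AddCommGroup (S i)] [∀ i, Module A (S i)] : Prop where
  mul_self : ∀ i ∈ I, e i * e i = e i
  mul_eq_zero : ∀ i ∈ I, ∀ j ∈ I, i ≠ j → e i * e j = 0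
  isSimpleModule : ∀ i ∈ I, IsSimpleModule A (S i)
  smul_eq : ∀ i ∈ I, ∀ s : S i, e i • s = s
  isCornerLocal : ∀ i ∈ I, IsCornerLocal (e i) (S i)
  nilpotent : ∀ i ∈ I, ∃ n, ∀ l : List A, l.length = n →
    (∀ x ∈ l, x ∈ cornerAnnihilator (e i) (S i)) →
    e i * l.prod ∈ AddSubgroup.closure {x | ∃ a b, a * (1 - ∑ i ∈ I, e i) * b = x}
  hasFiniteCorners : HasFiniteCorners I e

namespace IsSimpleSystem

variable {A : Type u} {ι : Type*} [Ring A] {I : Finset ι} {e : ι → A} {S : ι → Type u}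
  [∀ i, AddCommGroup (S i)] [∀ i, Module A (S i)]

theorem sum_mul [DecidableEq ι] (h : IsSimpleSystem I e S) {J : Finset ι} (hJ : J ⊆ I) {i : ι}
    (hi : i ∈ I) : (∑ j ∈ J, e j) * e i = if i ∈ J then e i else 0 := by
  rw [Finset.sum_mul]
  rw [Finset.sum_congr rfl (g := fun j => if i = j then e i else 0)]
  · simp
  · intro j hj
    by_cases hij : i = j
    · subst hij; simp [h.mul_self i hi]
    · simp [hij, h.mul_eq_zero j (hJ hj) i hi (Ne.symm hij)]

theorem mul_sum [DecidableEq ι] (h : IsSimpleSystem I e S) {J : Finset ι} (hJ : J ⊆ I) {i : ι}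
    (hi : i ∈ I) : e i * (∑ j ∈ J, e j) = if i ∈ J then e i else 0 := by
  rw [Finset.mul_sum]
  rw [Finset.sum_congr rfl (g := fun j => if i = j then e i else 0)]
  · simp
  · intro j hj
    by_cases hij : i = j
    · subst hij; simp [h.mul_self i hi]
    · simp [hij, h.mul_eq_zero i hi j (hJ hj) hij]

theorem mono (h : IsSimpleSystem I e S) {J : Finset ι} (hJ : J ⊆ I) : IsSimpleSystem J e S where
  mul_self i hi := h.mul_self i (hJ hi)
  mul_eq_zero i hi j hj := h.mul_eq_zero i (hJ hi) j (hJ hj)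
  isSimpleModule i hi := h.isSimpleModule i (hJ hi)
  smul_eq i hi := h.smul_eq i (hJ hi)
  isCornerLocal i hi := h.isCornerLocal i (hJ hi)
  nilpotent i hi := by
    classical
    obtain ⟨n, hn⟩ := h.nilpotent i (hJ hi)
    refine ⟨n, fun l hl hlm => AddSubgroup.closure_mono ?_ (hn l hl hlm)⟩
    rintro _ ⟨a, b, rfl⟩
    refine ⟨a * (1 - ∑ i ∈ I, e i), b, ?_⟩
    have : (∑ i ∈ I, e i) * (∑ j ∈ J, e j) = ∑ j ∈ J, e j := by
      rw [Finset.mul_sum]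
      exact Finset.sum_congr rfl fun j hj => by rw [h.sum_mul subset_rfl (hJ hj), if_pos (hJ hj)]
    rw [mul_assoc a, mul_sub, mul_one, sub_mul _ _ (∑ j ∈ J, e j), this, one_mul, sub_self,
      sub_zero]
  hasFiniteCorners C hC := h.hasFiniteCorners C (hC.trans hJ)

/-- Deleting no idempotent gives `φ 1 = 1`, so only zero is corner torsion, every module is
orthogonal, and the bound for `Γ` carries over to `A`. -/
theorem exists_extVanishes (h : IsSimpleSystem I e S) (M : Type u) [AddCommGroup M] [Module A M] :
    ∃ d, ∀ (N : Type u) [AddCommGroup N] [Module A N], ∀ k, d < k → ExtVanishes A M N k := by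
  obtain ⟨Γ, _, φ, hφ, h1, d, hd⟩ := h.hasFiniteCorners ∅ (Finset.empty_subset I)
  have hM : IsCornerOrthogonal φ M := fun L _ _ hL k => by
    have : Subsingleton L := subsingleton_of_forall_eq 0 fun z => by
      simpa [h1] using hL z
    exact ExtVanishes.of_subsingleton_right k
  refine ⟨d, fun N _ _ k hk => hM.extVanishes hφ (by omega) ?_⟩
  have := hd (ModuleCat.of Γ (CornerModule φ M))
  exact HasProjectiveDimensionLT.subsingleton _ d k hk.le _

variable {Γ : Type u} [Ring Γ] {φ : Γ →ₙ+* A} {a : ι}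

theorem smul_eq_of_isCornerTorsion (h1 : φ 1 = 1 - e a) {L : Type u} [AddCommGroup L] [Module A L]
    (hL : IsCornerTorsion φ L) (z : L) : e a • z = z := by
  have := hL z
  rw [h1, sub_smul, one_smul, sub_eq_zero] at this
  exact this.symm

/-- On a module where `e a` acts as the identity, `1 - ∑ i ∈ I, e i` acts as zero, and so does the
ideal it generates. The index `n` is uniform in the module. -/
theorem exists_isNilpotentOn (h : IsSimpleSystem I e S) (ha : a ∈ I) (h1 : φ 1 = 1 - e a) :
    ∃ n, ∀ (L : Type u) [AddCommGroup L] [Module A L], IsCornerTorsion φ L →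
      IsNilpotentOn (cornerAnnihilator (e a) (S a)) n L := by
  classical
  obtain ⟨n, hn⟩ := h.nilpotent a ha
  refine ⟨n, fun L _ _ hL l hl hlm z => ?_⟩
  have heL := smul_eq_of_isCornerTorsion h1 hL
  rw [← heL (l.prod • z), ← mul_smul]
  have := hn l hl hlm
  generalize e a * l.prod = y at this
  induction this using AddSubgroup.closure_induction with
  | mem y hy =>
    obtain ⟨x, b, rfl⟩ := hy
    rw [mul_smul, ← heL (b • z), mul_smul x, ← mul_smul _ (e a), sub_mul,
      h.sum_mul subset_rfl ha, if_pos ha, one_mul, sub_self, zero_smul, smul_zero]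
  | zero => rw [zero_smul]
  | add y z _ _ hy hz => rw [add_smul, hy, hz, add_zero]
  | neg y _ hy => rw [neg_smul, hy, neg_zero]

theorem isCornerOrthogonal_or (h : IsSimpleSystem I e S) (ha : a ∈ I) (hφ : IsCornerEmbedding φ)
    (h1 : φ 1 = 1 - e a) {d : ℕ} (hd : ∀ M : ModuleCat.{u} Γ, HasProjectiveDimensionLT M d)
    {M N : Type u} [AddCommGroup M] [Module A M] [AddCommGroup N] [Module A N] {l : ℕ}
    (hl : 0 < l ∨ IsCornerTorsion φ N) (hne : ¬ ExtVanishes A (S a) N l)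
    (hext : ∀ k, 0 < k → ExtVanishes Γ (CornerModule φ M) (CornerModule φ N) k)
    (hhom : ∀ h : CornerModule φ M →ₗ[Γ] CornerModule φ N, ∃ g : M →ₗ[A] N, map φ g = h) :
    IsCornerOrthogonal φ M ∨ ∃ t, l ≤ t ∧ ¬ ExtVanishes A M N t := by
  classical
  obtain ⟨b, hb⟩ := h.exists_extVanishes (S a)
  let P : ℕ → Prop := fun t => ¬ ExtVanishes A (S a) N t
  have hlb : l ≤ b := by
    by_contra hlb
    exact hne (hb N l (by omega))
  -- The dichotomy needs the largest degree in which `S a` has an extension by `N`; it is at least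
  -- the given `l`.
  have hm : P (Nat.findGreatest P b) := Nat.findGreatest_spec hlb hne
  have hlm : l ≤ Nat.findGreatest P b := Nat.le_findGreatest hlb hne
  have hgt : ∀ t, Nat.findGreatest P b < t → ExtVanishes A (S a) N t := fun t ht => by
    by_cases htb : t ≤ b
    · exact not_not.1 (Nat.findGreatest_is_greatest ht htb)
    · exact hb N t (by omega)
  generalize Nat.findGreatest P b = m at *
  obtain ⟨n, hn⟩ := h.exists_isNilpotentOn ha h1
  have := h.isSimpleModule a ha
  rcases isCornerOrthogonal_or_exists_not_extVanishes hφ (N := N) (l := m)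
    (hl.imp_left fun hl => hl.trans_le hlm)
    (fun L _ _ hL t ht => ExtVanishes.of_isNilpotentOn (h.mul_self a ha) (h.isCornerLocal a ha)
      (h.smul_eq a ha) (hgt t ht) n (smul_eq_of_isCornerTorsion h1 hL) (hn L hL))
    (fun L _ _ hL _ => not_extVanishes_of_isNilpotentOn (h.mul_self a ha) (h.isCornerLocal a ha)
      (h.smul_eq a ha) hm (hgt _ m.lt_succ_self) (smul_eq_of_isCornerTorsion h1 hL) (hn L hL))
    d (M := M) (hd _) hext hhom with h | ⟨t, ht, h⟩
  · exact Or.inl h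
  · exact Or.inr ⟨t, hlm.trans ht, h⟩

theorem isCornerTorsion (h : IsSimpleSystem I e S) (ha : a ∈ I) (h1 : φ 1 = 1 - e a) :
    IsCornerTorsion φ (S a) := fun s => by
  rw [h1, sub_smul, one_smul, h.smul_eq a ha, sub_self]

theorem extVanishes_self (h : IsSimpleSystem I e S) (ha : a ∈ I) {k : ℕ} (hk : 0 < k) :
    ExtVanishes A (S a) (S a) k := by
  by_contra hne
  obtain ⟨Γ, _, φ, hφ, h1, d, hd⟩ := h.hasFiniteCorners {a} (Finset.singleton_subset_iff.2 ha)
  rw [Finset.sum_singleton] at h1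
  have hS := h.isCornerTorsion ha h1
  have hS' := hS.cornerModule_subsingleton
  -- Take `M = A` and `N = S a`. As `fN = 0`, the hypotheses over `Γ` are vacuous. Both outcomes are
  -- absurd: `A` maps nontrivially to `S a`, and `A` is projective.
  rcases h.isCornerOrthogonal_or ha hφ h1 hd (M := A) (Or.inl hk) hne
    (fun k _ => ExtVanishes.of_subsingleton_right k) (fun h => ⟨0, Subsingleton.elim _ _⟩) with
    h' | ⟨t, ht, h'⟩
  · have := h.isSimpleModule a ha
    have := IsSimpleModule.nontrivial A (S a)
    obtain ⟨s, hs⟩ := exists_ne (0 : S a)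
    have := LinearMap.congr_fun (extVanishes_zero_iff.1 (h' _ hS 0)
      (LinearMap.toSpanSingleton A (S a) s)) 1
    exact hs (by simpa using this)
  · exact h' (ExtVanishes.of_projective (by omega))

theorem map_one_smul [DecidableEq ι] (h : IsSimpleSystem I e S) (ha : a ∈ I) (h1 : φ 1 = 1 - e a)
    {i : ι} (hi : i ∈ I.erase a) (s : S i) : φ 1 • s = s := by
  have hi' := Finset.mem_erase.1 hi
  rw [h1, sub_smul, one_smul, ← h.smul_eq i hi'.2 s, ← mul_smul, h.mul_eq_zero a ha i hi'.2 hi'.1.symm,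
    zero_smul, sub_zero]

theorem map_compress_eq [DecidableEq ι] (h : IsSimpleSystem I e S) (ha : a ∈ I)
    (hφ : IsCornerEmbedding φ) (h1 : φ 1 = 1 - e a)
    {i : ι} (hi : i ∈ I.erase a) : φ (hφ.compress (e i)) = e i := by
  have hi' := Finset.mem_erase.1 hi
  rw [hφ.map_compress, h1, sub_mul, one_mul, h.mul_eq_zero a ha i hi'.2 hi'.1.symm, sub_zero, mul_sub,
    mul_one, h.mul_eq_zero i hi'.2 a ha hi'.1, sub_zero]

/-- When `f` acts as the identity on both modules, `a` acts through `faf`, so `Γ`-linear maps are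
already `A`-linear. This supplies the lifting hypothesis of the dichotomy for the remaining simple
modules. -/
theorem exists_map_eq {M N : Type u} [AddCommGroup M] [Module A M] [AddCommGroup N] [Module A N]
    (hφ : IsCornerEmbedding φ) (hM : ∀ m : M, φ 1 • m = m) (hN : ∀ n : N, φ 1 • n = n)
    (h : CornerModule φ M →ₗ[Γ] CornerModule φ N) : ∃ g : M →ₗ[A] N, map φ g = h := by
  refine ⟨{ toFun := fun m => val (h (CornerModule.mk m (hM m)))
            map_add' := fun m n => ?_
            map_smul' := fun a m => ?_ }, ?_⟩
  · rw [← map_add, ← map_add]; rfl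
  · have : CornerModule.mk (a • m) (hM _) = hφ.compress a • CornerModule.mk m (hM m) := val_injective (by
      rw [val_smul, hφ.map_compress, val_mk, val_mk, mul_smul, mul_smul, hM, hM])
    rw [this, map_smul, val_smul, hφ.map_compress, mul_smul, mul_smul, hN, hN]; rfl
  · ext m; exact val_injective rfl

end IsSimpleSystem

end SimpleSystem

/-! ### Passage to corner rings, existence of a sink, and the order -/

section SimpleSystem

open CornerModule

namespace IsSimpleSystem

variable {A : Type u} {ι : Type*} [Ring A] {I : Finset ι} {e : ι → A} {S : ι → Type u}
  [∀ i, AddCommGroup (S i)] [∀ i, Module A (S i)]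
variable {Γ : Type u} [Ring Γ] {φ : Γ →ₙ+* A} {a : ι}

theorem isSimpleModule_cornerModule (hφ : IsCornerEmbedding φ) {M : Type u} [AddCommGroup M]
    [Module A M] [IsSimpleModule A M] (hM : ∀ m : M, φ 1 • m = m) :
    IsSimpleModule Γ (CornerModule φ M) := by
  rw [isSimpleModule_iff_toSpanSingleton_surjective]
  have := IsSimpleModule.nontrivial A M
  obtain ⟨m, hm⟩ := exists_ne (0 : M)
  refine ⟨⟨CornerModule.mk m (hM m), 0, fun h => hm (congrArg val h)⟩, fun z hz w => ?_⟩
  obtain ⟨x, hx⟩ := IsSimpleModule.toSpanSingleton_surjective A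
    (show val z ≠ 0 from fun h => hz (val_injective (h.trans (map_zero _).symm))) (val w)
  rw [LinearMap.toSpanSingleton_apply] at hx
  exact ⟨hφ.compress x, val_injective (by
    rw [LinearMap.toSpanSingleton_apply, val_smul, hφ.map_compress, mul_smul, mul_smul,
      map_one_smul_val, hx, map_one_smul_val])⟩

theorem map_mul_list_prod (φ : Γ →ₙ+* A) (y : Γ) (l : List Γ) :
    φ (y * l.prod) = φ y * (l.map φ).prod := by
  induction l generalizing y with
  | nil => simp
  | cons x l ih =>
    rw [List.prod_cons, ← mul_assoc, ih, map_mul, List.map_cons, List.prod_cons, mul_assoc]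

variable [DecidableEq ι]

/-- Deleting one idempotent of a simple system yields a simple system over the corner ring. -/
theorem corner (h : IsSimpleSystem I e S) (ha : a ∈ I) (hφ : IsCornerEmbedding φ)
    (h1 : φ 1 = 1 - e a) : IsSimpleSystem (I.erase a) (fun i => hφ.compress (e i))
      (fun i => CornerModule φ (S i)) := by
  have hI : ∀ {i}, i ∈ I.erase a → i ∈ I := fun hi => Finset.mem_of_mem_erase hi
  have he : ∀ {i}, i ∈ I.erase a → φ (hφ.compress (e i)) = e i := h.map_compress_eq ha hφ h1
  have hsum : ∀ {C}, C ⊆ I.erase a → φ (∑ i ∈ C, hφ.compress (e i)) = ∑ i ∈ C, e i :=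
    fun {C} hC => by
      rw [map_sum]; exact Finset.sum_congr rfl fun i hi => he (hC hi)
  have hsub : ∀ {C}, C ⊆ I.erase a → φ (1 - ∑ i ∈ C, hφ.compress (e i)) =
      1 - ∑ i ∈ insert a C, e i := fun {C} hC => by
    rw [map_sub, hsum hC, h1, Finset.sum_insert (fun ha' => (Finset.mem_erase.1 (hC ha')).1 rfl)]
    abel
  have hann : ∀ {i}, i ∈ I.erase a → ∀ {x},
      x ∈ cornerAnnihilator (hφ.compress (e i)) (CornerModule φ (S i)) →
      φ x ∈ cornerAnnihilator (e i) (S i) := fun {i} hi {x} hx =>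
    ⟨by rw [← he hi, ← map_mul, ← map_mul, hx.1], fun s =>
      congrArg val (hx.2 (CornerModule.mk s (h.map_one_smul ha h1 hi s)))⟩
  refine ⟨fun i hi => hφ.injective ?_, fun i hi j hj hij => hφ.injective ?_, fun i hi => ?_,
    fun i hi s => val_injective ?_, fun i hi x hx => ?_, fun i hi => ?_, fun C hC => ?_⟩
  · rw [map_mul, he hi, h.mul_self i (hI hi)]
  · rw [map_mul, he hi, he hj, h.mul_eq_zero i (hI hi) j (hI hj) hij, map_zero]
  · have := h.isSimpleModule i (hI hi)
    exact isSimpleModule_cornerModule hφ (h.map_one_smul ha h1 hi)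
  · rw [val_smul, he hi, h.smul_eq i (hI hi)]
  · rcases h.isCornerLocal i (hI hi) (φ x) (by rw [← he hi, ← map_mul, ← map_mul, hx]) with
      h' | ⟨y, hy⟩
    · exact Or.inl fun s => val_injective (h' _)
    · refine Or.inr ⟨hφ.compress y, hφ.injective ?_⟩
      rw [map_mul, hφ.map_compress, mul_assoc, map_one_mul_map, mul_assoc, hy]
      exact (congrArg (φ 1 * ·) (he hi).symm).trans (map_one_mul_map φ _)
  · obtain ⟨n, hn⟩ := h.nilpotent i (hI hi)
    refine ⟨n, fun l hl hlm => ?_⟩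
    have hmem := hn (l.map φ) (by simp [hl]) (by
      intro y hy
      obtain ⟨x, hx, rfl⟩ := List.mem_map.1 hy
      exact hann hi (hlm x hx))
    rw [← he hi, ← map_mul_list_prod] at hmem
    rw [← hφ.compress_map (_ * l.prod)]
    generalize φ _ = y at hmem
    induction hmem using AddSubgroup.closure_induction with
    | mem y hy =>
      obtain ⟨x, z, rfl⟩ := hy
      refine AddSubgroup.subset_closure ⟨hφ.compress x, hφ.compress z, hφ.injective ?_⟩
      have h2 := hsub (subset_refl (I.erase a))
      rw [Finset.insert_erase ha] at h2
      rw [← h2, map_mul, map_mul, hφ.map_compress, hφ.map_compress, hφ.map_compress]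
      simp only [mul_assoc, map_one_mul_map]
      simp only [← mul_assoc, map_mul_map_one]
    | zero => rw [map_zero]; exact zero_mem _
    | add y z _ _ hy hz => rw [map_add]; exact add_mem hy hz
    | neg y _ hy => rw [map_neg]; exact neg_mem hy
  · obtain ⟨Γ', _, ψ, hψ, hψ1, hd⟩ := h.hasFiniteCorners (insert a C)
      (Finset.insert_subset ha (hC.trans (Finset.erase_subset a I)))
    have hl : φ 1 * ψ 1 = ψ 1 := by rw [hψ1, ← hsub hC, map_one_mul_map]
    have hr : ψ 1 * φ 1 = ψ 1 := by rw [hψ1, ← hsub hC, map_mul_map_one]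
    have hc : ∀ x, φ (hφ.compress (ψ x)) = ψ x := fun x => by
      rw [hφ.map_compress, ← map_one_mul_map ψ, ← mul_assoc, hl, map_one_mul_map,
        ← map_mul_map_one ψ x, mul_assoc, hr]
    -- The ring obtained from `A` by deleting `a` and `C` embeds in `Γ` as the corner that remains
    -- after deleting `C`.
    let ψ' : Γ' →ₙ+* Γ :=
      { toFun := fun x => hφ.compress (ψ x)
        map_mul' := fun x y => hφ.injective (by rw [map_mul φ, hc, hc, hc, map_mul])
        map_zero' := by rw [map_zero, map_zero]
        map_add' := fun x y => by rw [map_add, map_add] }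
    have hc' : ∀ x, φ (ψ' x) = ψ x := hc
    refine ⟨Γ', _, ψ', ⟨fun x y hxy => hψ.injective ?_, fun x => ?_⟩, hφ.injective ?_, hd⟩
    · rw [← hc', hxy, hc']
    · obtain ⟨γ, hγ⟩ := hψ.exists_eq (φ x)
      exact ⟨γ, hφ.injective (by rw [map_mul, map_mul, hc', hc', hγ])⟩
    · rw [hc', hsub hC, hψ1]

end IsSimpleSystem

/-- A simple system has a sink for the relation given by the nonvanishing of extensions. -/
theorem exists_forall_extVanishes {ι : Type*} [DecidableEq ι] (I : Finset ι) (hI : I.Nonempty) :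
    ∀ {A : Type u} [Ring A] {e : ι → A} {S : ι → Type u} [∀ i, AddCommGroup (S i)]
      [∀ i, Module A (S i)], IsSimpleSystem I e S →
      ∃ i ∈ I, ∀ j ∈ I, ∀ k, 0 < k → ExtVanishes A (S i) (S j) k := by
  induction I using Finset.strongInduction with
  | H I ih =>
  intro A _ e S _ _ h
  by_contra hno
  let r : ι → ι → Prop := fun i j => ∃ k, 0 < k ∧ ¬ ExtVanishes A (S i) (S j) k
  have hr : ∀ i ∈ I, ∃ j ∈ I, r i j := by
    intro i hi
    by_contra hc
    refine hno ⟨i, hi, fun j hj k hk => ?_⟩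
    by_contra hne
    exact hc ⟨j, hj, k, hk, hne⟩
  have hself : ∀ i ∈ I, ¬ r i i := fun i hi ⟨k, hk, hne⟩ => hne (h.extVanishes_self hi hk)
  have hnonempty : ∀ a ∈ I, (I.erase a).Nonempty := fun a ha => by
    obtain ⟨j, hj, haj⟩ := hr a ha
    exact ⟨j, Finset.mem_erase.2 ⟨fun hja => hself a ha (hja ▸ haj), hj⟩⟩
  -- A sink `s` of `I \ {a}` has `a` as its only possible successor in `I`. Thus `a` is recovered
  -- from `s`, so the choice `σ` is injective, hence bijective, and every element has exactly one
  -- successor.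
  have hsink : ∀ a : I, ∃ s : I, (s : ι) ≠ a ∧ ∀ j ∈ I, r s j → j = a := by
    rintro ⟨a, ha⟩
    obtain ⟨s, hs, hsj⟩ := ih (I.erase a) (Finset.erase_ssubset ha) (hnonempty a ha)
      (h.mono (Finset.erase_subset a I))
    refine ⟨⟨s, Finset.mem_of_mem_erase hs⟩, Finset.ne_of_mem_erase hs, fun j hj hrj => ?_⟩
    obtain ⟨k, hk, hne⟩ := hrj
    by_contra hja
    exact hne (hsj j (Finset.mem_erase.2 ⟨hja, hj⟩) k hk)
  choose σ hσ hσr using hsink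
  have hσ_inj : Function.Injective σ := fun a b hab => by
    obtain ⟨j, hj, hrj⟩ := hr (σ a) (σ a).2
    exact Subtype.ext ((hσr a j hj hrj).symm.trans (hσr b j hj (hab ▸ hrj)))
  have hσ_surj : Function.Surjective σ := Finite.injective_iff_surjective.1 hσ_inj
  obtain ⟨a, ha⟩ := hI
  obtain ⟨Γ, _, φ, hφ, h1, d, hd⟩ := h.hasFiniteCorners {a} (Finset.singleton_subset_iff.2 ha)
  rw [Finset.sum_singleton] at h1
  obtain ⟨s, hs, hsj⟩ := ih (I.erase a) (Finset.erase_ssubset ha) (hnonempty a ha)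
    (h.corner ha hφ h1)
  have hsI := Finset.mem_of_mem_erase hs
  have hSa := h.isCornerTorsion ha h1
  obtain ⟨j, hj, hsrj⟩ := hr s hsI
  obtain ⟨b, hb⟩ := hσ_surj ⟨s, hsI⟩
  have huniq : ∀ i ∈ I, r s i → i = j := fun i hi hri => by
    have h2 := hσr b
    rw [hb] at h2
    exact (h2 i hi hri).trans (h2 j hj hsrj).symm
  -- The only successor of `s` is `j`. If `j = a`, let `t` be a successor of `a` and apply the
  -- dichotomy to `S s` and `S t`: either `Ext(S s, S a)` vanishes, or `t` is a second successor of
  -- `s`.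
  by_cases hja : j = a
  · subst hja
    obtain ⟨t, ht, k, hk, hjt⟩ := hr j hj
    have htj : t ≠ j := fun htj => hself j hj ⟨k, hk, htj ▸ hjt⟩
    have ht' : t ∈ I.erase j := Finset.mem_erase.2 ⟨htj, ht⟩
    rcases h.isCornerOrthogonal_or ha hφ h1 hd (M := S s) (Or.inl hk) hjt (hsj t ht')
      (IsSimpleSystem.exists_map_eq hφ (h.map_one_smul ha h1 hs) (h.map_one_smul ha h1 ht')) with
      h' | ⟨m, hm, h'⟩
    · obtain ⟨m, _, hne⟩ := hsrj
      exact hne (h' _ hSa m)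
    · exact htj (huniq t ht ⟨m, by omega, h'⟩)
  -- If `j ≠ a`, apply the dichotomy to `S s` and `S a`, starting from `Hom(S a, S a) ≠ 0` in degree
  -- zero. Either `Ext(S s, S j)` vanishes by comparison with `Γ`, or `a` is a second successor of
  -- `s`.
  · have hj' : j ∈ I.erase a := Finset.mem_erase.2 ⟨hja, hj⟩
    have := h.isSimpleModule a ha
    have := IsSimpleModule.nontrivial A (S a)
    have hSa' := hSa.cornerModule_subsingleton
    have hne0 : ¬ ExtVanishes A (S a) (S a) 0 := fun h0 => by
      obtain ⟨z, hz⟩ := exists_ne (0 : S a)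
      exact hz (LinearMap.congr_fun (extVanishes_zero_iff.1 h0 LinearMap.id) z)
    rcases h.isCornerOrthogonal_or ha hφ h1 hd (M := S s) (Or.inr hSa) hne0
      (fun k _ => ExtVanishes.of_subsingleton_right k) (fun h => ⟨0, Subsingleton.elim _ _⟩) with
      h' | ⟨m, -, h'⟩
    · obtain ⟨k, hk, hne⟩ := hsrj
      exact hne (h'.extVanishes hφ hk (hsj j hj' k hk))
    · rcases Nat.eq_zero_or_pos m with rfl | hm
      · refine h' (extVanishes_zero_iff.2 fun g => LinearMap.ext fun z => ?_)
        rw [← h.map_one_smul ha h1 hs z, map_smul, hSa]; rfl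
      · exact hja (huniq a ha ⟨m, hm, h'⟩).symm

/-- The simple modules of a simple system can be ordered such that all positive extensions from a
module to itself and to the preceding ones vanish. -/
theorem exists_order_extVanishes {ι : Type*} [DecidableEq ι] (I : Finset ι)
    {A : Type u} [Ring A] {e : ι → A} {S : ι → Type u} [∀ i, AddCommGroup (S i)]
    [∀ i, Module A (S i)] (h : IsSimpleSystem I e S) :
    ∃ l : List ι, l.Nodup ∧ l.toFinset = I ∧
      l.Pairwise (fun i j => ∀ k, 0 < k → ExtVanishes A (S j) (S i) k) ∧
      ∀ i ∈ l, ∀ k, 0 < k → ExtVanishes A (S i) (S i) k := by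
  induction I using Finset.strongInduction with
  | H I ih =>
  rcases I.eq_empty_or_nonempty with rfl | hI
  · exact ⟨[], by simp⟩
  · obtain ⟨i, hi, hij⟩ := exists_forall_extVanishes I hI h
    obtain ⟨l, hl, hlI, hlp, -⟩ := ih (I.erase i) (Finset.erase_ssubset hi)
      (h.mono (Finset.erase_subset i I))
    have hmem : ∀ j, j ∈ l ↔ j ∈ I.erase i := fun j => by rw [← hlI, List.mem_toFinset]
    refine ⟨l ++ [i], ?_, ?_, ?_, fun j hj k hk => h.extVanishes_self ?_ hk⟩
    · rw [List.nodup_append]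
      refine ⟨hl, by simp, fun x hx y hy hxy => ?_⟩
      rw [List.mem_singleton.1 hy] at hxy
      exact Finset.ne_of_mem_erase ((hmem x).1 hx) hxy
    · rw [List.toFinset_append, hlI]
      ext x
      by_cases hx : x = i <;> simp [hx, hi]
    · rw [List.pairwise_append]
      refine ⟨hlp, by simp, fun x hx y hy => ?_⟩
      rw [List.mem_singleton.1 hy]
      exact hij x (Finset.mem_of_mem_erase ((hmem x).1 hx))
    · rcases List.mem_append.1 hj with hj | hj
      · exact Finset.mem_of_mem_erase ((hmem j).1 hj)
      · rw [List.mem_singleton.1 hj]; exact hi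

end SimpleSystem

/-! ### Idempotents in semiperfect and basic rings -/

section Semiperfect

variable {R : Type u} [Ring R]

theorem isUnit_one_sub_of_mem_jacobson {x : R} (hx : x ∈ Ring.jacobson R) : IsUnit (1 - x) := by
  have key : ∀ x ∈ Ring.jacobson R, ∃ z, z * (1 - x) = 1 := fun x hx => by
    rw [← Ideal.jacobson_bot, Ideal.mem_jacobson_iff] at hx
    obtain ⟨z, hz⟩ := hx (-1)
    refine ⟨z, ?_⟩
    rw [Ideal.mem_bot, sub_eq_zero, mul_neg_one, neg_mul] at hz
    rw [mul_sub, mul_one, sub_eq_add_neg, add_comm, hz]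
  obtain ⟨z, hz⟩ := key x hx
  obtain ⟨w, hw⟩ := key (-(z * x)) (neg_mem (Ideal.mul_mem_left _ z hx))
  have h1 : 1 - -(z * x) = z := by
    rw [mul_sub, mul_one, sub_eq_iff_eq_add] at hz
    rw [sub_neg_eq_add, ← hz]
  rw [h1] at hw
  have h2 : w = 1 - x := by
    calc w = w * (z * (1 - x)) := by rw [hz, mul_one]
      _ = 1 - x := by rw [← mul_assoc, hw, one_mul]
  exact ⟨⟨1 - x, z, h2 ▸ hw, hz⟩, rfl⟩

theorem op_mem_jacobson {x : R} (hx : x ∈ Ring.jacobson R) :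
    MulOpposite.op x ∈ Ring.jacobson Rᵐᵒᵖ := by
  rw [← Ideal.jacobson_bot, Ideal.mem_jacobson_iff]
  intro y
  obtain ⟨u, hu⟩ := isUnit_one_sub_of_mem_jacobson
    (neg_mem (Ideal.mul_mem_right y.unop _ hx))
  refine ⟨MulOpposite.op (↑u⁻¹ : R), ?_⟩
  rw [Ideal.mem_bot, sub_eq_zero]
  apply MulOpposite.unop_injective
  have := u.mul_inv
  rw [hu, sub_neg_eq_add, add_mul, one_mul, add_comm] at this
  simpa [mul_assoc] using this

theorem eq_zero_of_op_mem_jacobson {x : R} (hx : MulOpposite.op x ∈ Ring.jacobson Rᵐᵒᵖ)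
    (hi : IsIdempotentElem x) : x = 0 := by
  have h := isUnit_one_sub_of_mem_jacobson hx
  have h2 : (1 - MulOpposite.op x) * MulOpposite.op x = 0 := by
    rw [sub_mul, one_mul, ← MulOpposite.op_mul, hi.eq, sub_self]
  exact MulOpposite.op_injective (h.mul_right_eq_zero.1 h2)

theorem mul_mem_jacobson_right {x : R} (hx : x ∈ Ring.jacobson R) (y : R) :
    x * y ∈ Ring.jacobson R := Ideal.mul_mem_right y _ hx

theorem mul_mem_jacobson_left {x : R} (hx : x ∈ Ring.jacobson R) (y : R) :
    y * x ∈ Ring.jacobson R := Ideal.mul_mem_left _ y hx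

theorem mk_jacobson_eq_iff {x y : R} : Ideal.Quotient.mk (Ring.jacobson R) x =
    Ideal.Quotient.mk (Ring.jacobson R) y ↔ x - y ∈ Ring.jacobson R := Ideal.Quotient.eq

theorem mem_idempotentRightIdeal {e : R} (he : IsIdempotentElem e) {r : R} :
    r ∈ idempotentRightIdeal e ↔ e * r = r := by
  rw [idempotentRightIdeal, Submodule.mem_span_singleton]
  constructor
  · rintro ⟨a, rfl⟩
    rw [MulOpposite.smul_eq_mul_unop, ← mul_assoc, he.eq]
  · exact fun h => ⟨MulOpposite.op r, h⟩

/-- Elements of `eRf` and `fRe` that are mutually inverse give an isomorphism of `eR` with `fR`. -/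
def idempotentRightIdealEquiv {e f x y : R} (he : IsIdempotentElem e) (hf : IsIdempotentElem f)
    (hex : e * x = x) (hfy : f * y = y) (hxy : x * y = e) (hyx : y * x = f) :
    idempotentRightIdeal e ≃ₗ[Rᵐᵒᵖ] idempotentRightIdeal f where
  toFun r := ⟨y * r, by rw [mem_idempotentRightIdeal hf, ← mul_assoc, hfy]⟩
  invFun r := ⟨x * r, by rw [mem_idempotentRightIdeal he, ← mul_assoc, hex]⟩
  map_add' r s := Subtype.ext (mul_add y _ _)
  map_smul' a r := Subtype.ext (by simp [MulOpposite.smul_eq_mul_unop, mul_assoc])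
  left_inv r := Subtype.ext (by
    change x * (y * r) = r
    rw [← mul_assoc, hxy, (mem_idempotentRightIdeal he).1 r.2])
  right_inv r := Subtype.ext (by
    change y * (x * r) = r
    rw [← mul_assoc, hyx, (mem_idempotentRightIdeal hf).1 r.2])

namespace IsSemiperfectRing

/-- A semisimple ring is von Neumann regular: the left ideal generated by `x` is generated by an
idempotent. -/
theorem exists_mul_mul_eq (hR : IsSemiperfectRing R) (x : R ⧸ Ring.jacobson R) : ∃ y, x * y * x = x := by
  have := hR.isSemisimpleRing_quotient
  obtain ⟨g, hg, hxg⟩ := IsSemisimpleRing.ideal_eq_span_idempotent (Ideal.span {x})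
  obtain ⟨y, hy⟩ := Ideal.mem_span_singleton'.1 (hxg ▸ Ideal.mem_span_singleton_self g)
  obtain ⟨z, hz⟩ := Ideal.mem_span_singleton'.1 (hxg ▸ Ideal.mem_span_singleton_self x)
  refine ⟨y, ?_⟩
  rw [mul_assoc, hy, ← hz, mul_assoc, hg.eq]

theorem exists_lift_corner (hR : IsSemiperfectRing R) {e g : R} (he : IsIdempotentElem e) (heg : e * g * e = g)
    (hg : IsIdempotentElem (Ideal.Quotient.mk (Ring.jacobson R) g)) :
    ∃ h : R, IsIdempotentElem h ∧ e * h = h ∧ h * e = h ∧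
      Ideal.Quotient.mk (Ring.jacobson R) h = Ideal.Quotient.mk (Ring.jacobson R) g := by
  obtain ⟨f, hf, hfg⟩ := hR.exists_lift _ hg
  have hge : g * e = g := by rw [← heg, mul_assoc _ e e, he.eq]
  have heg' : e * g = g := by rw [← heg, ← mul_assoc, ← mul_assoc, he.eq]
  have hJ : f * (1 - e) ∈ Ring.jacobson R := by
    rw [← Ideal.Quotient.eq_zero_iff_mem, map_mul, hfg, ← map_mul, mul_sub, mul_one, hge, sub_self,
      map_zero]
  -- The lift `f` need not lie in `eRe`. The unit `u = 1 - f(1-e)` satisfies `fu = fe`, which makes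
  -- `e u⁻¹ f e` an idempotent of `eRe` with the same residue.
  obtain ⟨u, hu⟩ := isUnit_one_sub_of_mem_jacobson hJ
  have hfu : f * u = f * e := by
    rw [hu, mul_sub, mul_one, ← mul_assoc, hf.eq]; noncomm_ring
  have hπu : Ideal.Quotient.mk (Ring.jacobson R) (u : R) = 1 := by
    rw [hu, map_sub, map_one, Ideal.Quotient.eq_zero_iff_mem.2 hJ, sub_zero]
  have hπu' : Ideal.Quotient.mk (Ring.jacobson R) (↑u⁻¹ : R) = 1 := by
    have := congrArg (Ideal.Quotient.mk (Ring.jacobson R)) u.inv_mul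
    rwa [map_mul, hπu, mul_one, map_one] at this
  refine ⟨e * ↑u⁻¹ * (f * e), ?_, ?_, ?_, ?_⟩
  · change e * ↑u⁻¹ * (f * e) * (e * ↑u⁻¹ * (f * e)) = e * ↑u⁻¹ * (f * e)
    calc e * ↑u⁻¹ * (f * e) * (e * ↑u⁻¹ * (f * e))
        = e * ↑u⁻¹ * (f * (e * e)) * ↑u⁻¹ * (f * e) := by simp only [mul_assoc]
      _ = e * ↑u⁻¹ * f * (u * ↑u⁻¹) * (f * e) := by rw [he.eq, ← hfu]; simp only [mul_assoc]
      _ = e * ↑u⁻¹ * (f * f * e) := by rw [u.mul_inv]; simp only [mul_assoc, one_mul]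
      _ = _ := by rw [hf.eq]
  · simp only [← mul_assoc, he.eq]
  · rw [mul_assoc, mul_assoc f, he.eq]
  · rw [map_mul, map_mul, hπu', mul_one, map_mul, hfg, ← map_mul, ← map_mul, hge, heg']

theorem mk_eq_zero_or_eq (hR : IsSemiperfectRing R) {e g : R} (he : IsPrimitiveIdempotentElem e) (heg : e * g * e = g)
    (hg : IsIdempotentElem (Ideal.Quotient.mk (Ring.jacobson R) g)) :
    Ideal.Quotient.mk (Ring.jacobson R) g = 0 ∨
      Ideal.Quotient.mk (Ring.jacobson R) g = Ideal.Quotient.mk (Ring.jacobson R) e := by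
  obtain ⟨h, hh, h1, h2, h3⟩ := hR.exists_lift_corner he.isIdempotentElem heg hg
  have hi : IsIdempotentElem (e - h) := by
    change (e - h) * (e - h) = e - h
    rw [sub_mul, mul_sub, mul_sub, he.isIdempotentElem.eq, h1, h2, hh.eq, sub_self, sub_zero]
  rcases he.eq_zero_or_eq_zero h (e - h) hh hi (by rw [mul_sub, h2, hh.eq, sub_self])
    (by rw [sub_mul, h1, hh.eq, sub_self]) (by abel) with h0 | h0
  · left; rw [← h3, h0, map_zero]
  · right; rw [← h3, sub_eq_zero.1 h0]

/-- For a primitive idempotent `e` of a semiperfect ring, every element of `eRf` outside the Jacobson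
radical has a right inverse in `fRe`. -/
theorem exists_mul_eq (hR : IsSemiperfectRing R) {e f x : R} (he : IsPrimitiveIdempotentElem e) (hf : IsIdempotentElem f)
    (hex : e * x = x) (hxf : x * f = x) (hxJ : x ∉ Ring.jacobson R) :
    ∃ y, f * y = y ∧ y * e = y ∧ x * y = e := by
  have hee := he.isIdempotentElem.eq
  obtain ⟨y₀, hy₀⟩ := hR.exists_mul_mul_eq (Ideal.Quotient.mk _ x)
  obtain ⟨y₀, rfl⟩ := Ideal.Quotient.mk_surjective y₀
  have hg : e * (x * y₀ * e) * e = x * y₀ * e := by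
    rw [← mul_assoc, ← mul_assoc, hex, mul_assoc _ e e, hee]
  have hgx : Ideal.Quotient.mk (Ring.jacobson R) (x * y₀ * e) *
      Ideal.Quotient.mk (Ring.jacobson R) x = Ideal.Quotient.mk (Ring.jacobson R) x := by
    rw [← map_mul, mul_assoc _ e x, hex, map_mul, map_mul, hy₀]
  have hgi : IsIdempotentElem (Ideal.Quotient.mk (Ring.jacobson R) (x * y₀ * e)) := by
    change _ * _ = _
    nth_rw 2 [mul_assoc x]
    rw [map_mul _ x, ← mul_assoc, hgx, ← map_mul, mul_assoc]
  -- Modulo the radical, `x y₀ e` is an idempotent fixing `x ≠ 0`, so by primitivity it is congruent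
  -- to `e`; a unit congruent to `1` corrects the congruence to an equality.
  rcases hR.mk_eq_zero_or_eq he hg hgi with h0 | h1
  · rw [h0, zero_mul] at hgx
    exact absurd (Ideal.Quotient.eq_zero_iff_mem.1 hgx.symm) hxJ
  · obtain ⟨u, hu⟩ := isUnit_one_sub_of_mem_jacobson (mk_jacobson_eq_iff.1 h1.symm)
    refine ⟨f * y₀ * e * ↑u⁻¹ * e, ?_, ?_, ?_⟩
    · simp only [← mul_assoc, hf.eq]
    · rw [mul_assoc, hee]
    · have h2 : e * (u : R) = x * y₀ * e := by
        rw [hu, mul_sub, mul_sub, hee, mul_one, sub_sub_cancel, ← mul_assoc, ← mul_assoc, hex]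
      calc x * (f * y₀ * e * ↑u⁻¹ * e) = (x * f) * y₀ * e * ↑u⁻¹ * e := by simp only [mul_assoc]
        _ = e * u * ↑u⁻¹ * e := by rw [hxf, h2]
        _ = e := by rw [mul_assoc e, u.mul_inv, mul_one, hee]

/-- If `xy = e`, then `yx` is a nonzero idempotent of `fRf`, hence equal to `f` by primitivity; so
`x` and `y` are mutually inverse. -/
theorem nonempty_idempotentRightIdeal_equiv (hR : IsSemiperfectRing R) {e f x : R} (he : IsPrimitiveIdempotentElem e)
    (hf : IsPrimitiveIdempotentElem f) (hex : e * x = x) (hxf : x * f = x)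
    (hxJ : x ∉ Ring.jacobson R) :
    Nonempty (idempotentRightIdeal e ≃ₗ[Rᵐᵒᵖ] idempotentRightIdeal f) := by
  obtain ⟨y, hfy, hye, hxy⟩ := hR.exists_mul_eq he hf.isIdempotentElem hex hxf hxJ
  have hi : IsIdempotentElem (y * x) := by
    change y * x * (y * x) = y * x
    rw [mul_assoc, ← mul_assoc x, hxy, hex]
  have h1 : f * (y * x) = y * x := by rw [← mul_assoc, hfy]
  have h2 : y * x * f = y * x := by rw [mul_assoc, hxf]
  have hi' : IsIdempotentElem (f - y * x) := by
    change (f - y * x) * (f - y * x) = f - y * x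
    rw [sub_mul, mul_sub, mul_sub, hf.isIdempotentElem.eq, h1, h2, hi.eq, sub_self, sub_zero]
  rcases hf.eq_zero_or_eq_zero (y * x) (f - y * x) hi hi' (by rw [mul_sub, h2, hi.eq, sub_self])
    (by rw [sub_mul, h1, hi.eq, sub_self]) (by abel) with h0 | h0
  · refine absurd ?_ he.ne_zero
    rw [← he.isIdempotentElem.eq]
    nth_rw 2 [← hxy]
    rw [← hxy, mul_assoc, ← mul_assoc y, h0, zero_mul, mul_zero]
  · exact ⟨idempotentRightIdealEquiv he.isIdempotentElem hf.isIdempotentElem hex hfy hxy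
      (sub_eq_zero.1 h0).symm⟩

end IsSemiperfectRing

/-- A complete family of orthogonal idempotents whose corners are local and whose off-diagonal
components lie in the Jacobson radical. -/
structure IsBasicFamily {n : ℕ} (c : Fin n → R) : Prop where
  complete : CompleteOrthogonalIdempotents c
  ne_zero : ∀ i, c i ≠ 0
  exists_mul_eq : ∀ i x, c i * x = x → x * c i = x → x ∉ Ring.jacobson R →
    ∃ y, c i * y = y ∧ y * c i = y ∧ x * y = c i
  mul_mul_mem : ∀ i j, i ≠ j → ∀ x, c i * x * c j ∈ Ring.jacobson R

theorem IsSemiperfectRing.exists_isBasicFamily (hR : IsSemiperfectRing R) (hb : IsBasicRing R) :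
    ∃ (n : ℕ) (c : Fin n → R), IsBasicFamily c := by
  obtain ⟨n, c, hc, hp, hiso⟩ := hb
  refine ⟨n, c, hc, fun i => (hp i).ne_zero, fun i x h1 h2 h3 =>
    hR.exists_mul_eq (hp i) (hp i).isIdempotentElem h1 h2 h3, fun i j hij x => ?_⟩
  by_contra hx
  exact hij (hiso i j (hR.nonempty_idempotentRightIdeal_equiv (hp i) (hp j)
    (by rw [← mul_assoc, ← mul_assoc, (hp i).isIdempotentElem.eq])
    (by rw [mul_assoc, (hp j).isIdempotentElem.eq]) hx))

theorem IsBasicFamily.conj {n : ℕ} {c : Fin n → R} (h : IsBasicFamily c) (u : Rˣ) :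
    IsBasicFamily (fun i => ↑u⁻¹ * c i * u) := by
  have hmul : ∀ i j, (↑u⁻¹ * c i * u : R) * (↑u⁻¹ * c j * u) = ↑u⁻¹ * (c i * c j) * u := by
    intro i j
    calc (↑u⁻¹ * c i * u : R) * (↑u⁻¹ * c j * u)
        = ↑u⁻¹ * c i * (u * ↑u⁻¹) * c j * u := by simp only [mul_assoc]
      _ = _ := by rw [u.mul_inv, mul_one]; simp only [mul_assoc]
  refine ⟨⟨⟨fun i => ?_, fun i j hij => ?_⟩, ?_⟩, fun i hi => h.ne_zero i ?_,
    fun i x h1 h2 h3 => ?_, fun i j hij x => ?_⟩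
  · change _ * _ = _
    rw [hmul, (h.complete.idem i).eq]
  · change (↑u⁻¹ * c i * u : R) * (↑u⁻¹ * c j * u) = 0
    rw [hmul, h.complete.ortho hij, mul_zero, zero_mul]
  · rw [← Finset.sum_mul, ← Finset.mul_sum, h.complete.complete, mul_one, u.inv_mul]
  · rwa [Units.mul_left_eq_zero, Units.mul_right_eq_zero] at hi
  · have h1' : c i * (u * x * ↑u⁻¹) = u * x * ↑u⁻¹ := by
      conv_rhs => rw [← h1]
      simp only [← mul_assoc, u.mul_inv, one_mul]
    have h2' : (u * x * ↑u⁻¹) * c i = u * x * ↑u⁻¹ := by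
      conv_rhs => rw [← h2]
      simp only [mul_assoc, u.mul_inv, mul_one]
    obtain ⟨y, hy1, hy2, hy3⟩ := h.exists_mul_eq i _ h1' h2' fun hx => h3 (by
      have := mul_mem_jacobson_right (mul_mem_jacobson_left hx (↑u⁻¹ : R)) (u : R)
      simpa [← mul_assoc] using this)
    refine ⟨↑u⁻¹ * y * u, ?_, ?_, ?_⟩
    · calc (↑u⁻¹ * c i * u : R) * (↑u⁻¹ * y * u) = ↑u⁻¹ * c i * (u * ↑u⁻¹) * y * u := by
            simp only [mul_assoc]
        _ = _ := by rw [u.mul_inv, mul_one, mul_assoc _ (c i), hy1]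
    · calc (↑u⁻¹ * y * u : R) * (↑u⁻¹ * c i * u) = ↑u⁻¹ * y * (u * ↑u⁻¹) * c i * u := by
            simp only [mul_assoc]
        _ = _ := by rw [u.mul_inv, mul_one, mul_assoc _ y, hy2]
    · rw [← hy3]
      simp only [← mul_assoc, u.inv_mul, one_mul]
  · have := mul_mem_jacobson_right (mul_mem_jacobson_left
      (h.mul_mul_mem i j hij (u * x * ↑u⁻¹)) (↑u⁻¹ : R)) (u : R)
    simpa only [mul_assoc] using this

/-- In a ring with a basic family, every idempotent is a partial sum of a basic family. -/
theorem IsBasicFamily.exists_eq_sum {n : ℕ} {p : Fin n → R} (h : IsBasicFamily p) {e : R}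
    (he : IsIdempotentElem e) :
    ∃ (c : Fin n → R) (I : Finset (Fin n)), IsBasicFamily c ∧ e = ∑ i ∈ I, c i := by
  classical
  let π := Ideal.Quotient.mk (Ring.jacobson R)
  have hidem : ∀ i, p i * p i = p i := fun i => (h.complete.idem i).eq
  have h0 : ∀ i j, i ≠ j → ∀ x, π (p i) * π x * π (p j) = 0 := fun i j hij x => by
    rw [← map_mul, ← map_mul]
    exact Ideal.Quotient.eq_zero_iff_mem.2 (h.mul_mul_mem i j hij x)
  have hsum : ∑ i, π (p i) = 1 := by rw [← map_sum, h.complete.complete, map_one]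
  -- Off-diagonal components vanish modulo the radical, so each `p i` becomes central there. Since
  -- the diagonal corners are local, the component of `e` at `i` is `0` or `p i`.
  have hl : ∀ i x, π (p i) * π x = π (p i) * π x * π (p i) := fun i x => by
    conv_lhs => rw [← mul_one (π (p i) * π x), ← hsum, Finset.mul_sum]
    exact Finset.sum_eq_single i (fun j _ hj => h0 i j hj.symm x) (by simp)
  have hr : ∀ i x, π x * π (p i) = π (p i) * π x * π (p i) := fun i x => by
    conv_lhs => rw [← one_mul (π x), ← hsum, Finset.sum_mul, Finset.sum_mul]
    exact Finset.sum_eq_single i (fun j _ hj => h0 j i hj x) (by simp)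
  have hdich : ∀ i, π (p i * e * p i) = 0 ∨ π (p i * e * p i) = π (p i) := by
    intro i
    by_cases hJ : p i * e * p i ∈ Ring.jacobson R
    · exact Or.inl (Ideal.Quotient.eq_zero_iff_mem.2 hJ)
    · right
      obtain ⟨y, h1, h2, h3⟩ := h.exists_mul_eq i _ (by simp only [← mul_assoc, hidem])
        (by rw [mul_assoc, hidem]) hJ
      have hsq : π (p i * e * p i) * π (p i * e * p i) = π (p i * e * p i) := by
        calc π (p i * e * p i) * π (p i * e * p i)
            = π (p i) * π e * (π (p i * p i) * π e * π (p i)) := by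
              simp only [map_mul, mul_assoc]
          _ = π (p i) * π e * (π (p i) * π e * π (p i)) := by rw [hidem]
          _ = π (p i) * π (e * e) * π (p i) := by
              rw [← hr, map_mul]; simp only [mul_assoc]
          _ = _ := by rw [he.eq, map_mul, map_mul]
      have := congrArg (· * π y) hsq
      change π _ * π _ * π y = π _ * π y at this
      rw [mul_assoc, ← map_mul, h3, ← map_mul, mul_assoc, hidem] at this
      exact this
  let I : Finset (Fin n) := Finset.univ.filter fun i => π (p i * e * p i) ≠ 0
  let f := ∑ i ∈ I, p i
  have hπ : π e = π f := by
    rw [← one_mul (π e), ← hsum, Finset.sum_mul, map_sum, Finset.sum_filter]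
    refine Finset.sum_congr rfl fun i _ => ?_
    rw [hl, ← map_mul, ← map_mul]
    by_cases hi : π (p i * e * p i) = 0
    · rw [if_neg (not_not.2 hi), hi]
    · rw [if_pos hi, (hdich i).resolve_left hi]
  have hf : f * f = f := by
    simp only [f, Finset.sum_mul_sum]
    refine Finset.sum_congr rfl fun i hi => ?_
    rw [Finset.sum_eq_single i (fun j _ hj => h.complete.ortho hj.symm) (fun h => absurd hi h),
      hidem]
  -- Congruent idempotents are conjugate: `u = fe + (1-f)(1-e)` is a unit with `ue = fu`.
  have hu : 1 - (f * e + (1 - f) * (1 - e)) ∈ Ring.jacobson R := by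
    rw [← Ideal.Quotient.eq_zero_iff_mem]
    change π _ = 0
    simp only [map_sub, map_add, map_mul, map_one, hπ]
    have : π f * π f = π f := by rw [← map_mul, hf]
    simp only [sub_mul, mul_sub, this, one_mul, mul_one]; abel
  obtain ⟨u, hu⟩ := isUnit_one_sub_of_mem_jacobson hu
  rw [sub_sub_cancel] at hu
  have h1 : u * e = f * u := by
    rw [hu]
    simp only [mul_add, add_mul, sub_mul, mul_sub, one_mul, mul_one, mul_assoc, he.eq]
    simp only [← mul_assoc, hf]; abel
  refine ⟨fun i => ↑u⁻¹ * p i * u, I, h.conj u, ?_⟩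
  rw [← Finset.sum_mul, ← Finset.mul_sum]
  change e = ↑u⁻¹ * f * u
  rw [mul_assoc, ← h1, ← mul_assoc, u.inv_mul, one_mul]

end Semiperfect

/-! ### Passage to `Rᵐᵒᵖ`: global dimension and nilpotency of the radical -/

section Transfer

theorem exists_hasProjectiveDimensionLT_of_rightGlobalDimension_lt_top {B : Type u} [Ring B]
    (h : rightGlobalDimension B < ⊤) :
    ∃ d, ∀ M : ModuleCat.{u} Bᵐᵒᵖ, HasProjectiveDimensionLT M d := by
  obtain ⟨d, hd⟩ : ∃ d : ℕ, rightGlobalDimension B ≤ d := by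
    generalize rightGlobalDimension B = x at h
    induction x using WithBot.recBotCoe with
    | bot => exact ⟨0, bot_le⟩
    | coe x =>
      induction x using WithTop.recTopCoe with
      | top => exact absurd h (lt_irrefl _)
      | coe x => exact ⟨x, le_rfl⟩
  exact ⟨d + 1, fun M => (projectiveDimension_le_iff M d).1
    ((le_iSup (fun M : ModuleCat.{u} Bᵐᵒᵖ => projectiveDimension M) M).trans hd)⟩

variable {R : Type u} [Ring R]

theorem op_finsetSum {ι : Type*} (s : Finset ι) (f : ι → R) :
    MulOpposite.op (∑ i ∈ s, f i) = ∑ i ∈ s, MulOpposite.op (f i) :=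
  map_sum (MulOpposite.opAddEquiv : R ≃+ Rᵐᵒᵖ) f s

/-- The inclusion of the opposite of the corner ring `fRf` into `Rᵐᵒᵖ`. -/
def cornerOpEmbedding {f : R} (hf : IsIdempotentElem f) : hf.Cornerᵐᵒᵖ →ₙ+* Rᵐᵒᵖ where
  toFun x := MulOpposite.op x.unop.1
  map_mul' _ _ := rfl
  map_zero' := rfl
  map_add' _ _ := rfl

theorem isCornerEmbedding_cornerOpEmbedding {f : R} (hf : IsIdempotentElem f) :
    IsCornerEmbedding (cornerOpEmbedding hf) where
  injective _ _ h := MulOpposite.unop_injective (Subtype.ext (MulOpposite.op_injective h))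
  exists_eq x := ⟨MulOpposite.op ⟨f * x.unop * f, x.unop, rfl⟩,
    MulOpposite.unop_injective (mul_assoc f x.unop f)⟩

theorem IsBasicFamily.hasFiniteCorners {n : ℕ} {c : Fin n → R} (hc : IsBasicFamily c)
    {I : Finset (Fin n)}
    (hgldim : ∀ (e' : R) (he' : IsIdempotentElem e'), IsSandwiched (∑ i ∈ I, c i) e' →
      rightGlobalDimension (idempotentSubring he') < ⊤) :
    HasFiniteCorners I (fun i => MulOpposite.op (c i)) := by
  intro C hC
  have hsum : ∀ {C D : Finset (Fin n)}, C ⊆ D → (∑ i ∈ C, c i) * (∑ i ∈ D, c i) = ∑ i ∈ C, c i ∧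
      (∑ i ∈ D, c i) * (∑ i ∈ C, c i) = ∑ i ∈ C, c i := by
    intro C D hCD
    constructor
    · rw [Finset.sum_mul]
      refine Finset.sum_congr rfl fun i hi => ?_
      rw [Finset.mul_sum, Finset.sum_eq_single i (fun j _ hj => hc.complete.ortho hj.symm)
        (fun h => absurd (hCD hi) h), (hc.complete.idem i).eq]
    · rw [Finset.mul_sum]
      refine Finset.sum_congr rfl fun i hi => ?_
      rw [Finset.sum_mul, Finset.sum_eq_single i (fun j _ hj => hc.complete.ortho hj)
        (fun h => absurd (hCD hi) h), (hc.complete.idem i).eq]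
  have hi : IsIdempotentElem (∑ i ∈ C, c i) := (hsum subset_rfl).1
  refine ⟨_, _, cornerOpEmbedding hi.one_sub, isCornerEmbedding_cornerOpEmbedding _, ?_,
    exists_hasProjectiveDimensionLT_of_rightGlobalDimension_lt_top
      (hgldim _ hi ⟨(hsum hC).1, (hsum hC).2⟩)⟩
  rw [← op_finsetSum]
  rfl

theorem list_prod_mem_pow {B : Type u} [Ring B] (I : Ideal B) [I.IsTwoSided] (l : List B) (hl : ∀ x ∈ l, x ∈ I) :
    l.prod ∈ I ^ l.length := by
  induction l with
  | nil => simp [Submodule.pow_zero, Ideal.one_eq_top]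
  | cons x l ih =>
    rw [List.prod_cons, List.length_cons, Ideal.IsTwoSided.pow_succ]
    exact Ideal.mul_mem_mul (hl x List.mem_cons_self)
      (ih fun y hy => hl y (List.mem_cons_of_mem x hy))

/-- The opposite of `R/⟨f⟩` is artinian, so its Jacobson radical is nilpotent, and the radical of
`R` maps into it. -/
theorem exists_list_prod_mem_span {f : R}
    (h : IsArtinianRing ((TwoSidedIdeal.span {f} : TwoSidedIdeal R).ringCon.Quotient)ᵐᵒᵖ) :
    ∃ n, ∀ l : List Rᵐᵒᵖ, l.length = n → (∀ x ∈ l, x.unop ∈ Ring.jacobson R) →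
      l.prod.unop ∈ TwoSidedIdeal.span {f} := by
  let ρ : R →+* (TwoSidedIdeal.span {f} : TwoSidedIdeal R).ringCon.Quotient :=
    (TwoSidedIdeal.span {f} : TwoSidedIdeal R).ringCon.mk'
  have hρ : Function.Surjective ρ.op := fun x => by
    obtain ⟨y, hy⟩ := (TwoSidedIdeal.span {f} : TwoSidedIdeal R).ringCon.mk'_surjective x.unop
    exact ⟨MulOpposite.op y, MulOpposite.unop_injective hy⟩
  have : RingHomSurjective ρ.op := ⟨hρ⟩
  obtain ⟨n, hn⟩ := IsSemiprimaryRing.isNilpotent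
    (R := ((TwoSidedIdeal.span {f} : TwoSidedIdeal R).ringCon.Quotient)ᵐᵒᵖ)
  refine ⟨n, fun l hl hlm => ?_⟩
  have hmem := list_prod_mem_pow (Ring.jacobson _) (l.map ρ.op) (by
    intro y hy
    obtain ⟨x, hx, rfl⟩ := List.mem_map.1 hy
    exact Ring.le_comap_jacobson ρ.op (op_mem_jacobson (hlm x hx)))
  rw [List.length_map, hl, hn, ← map_list_prod] at hmem
  have h0 : ρ l.prod.unop = 0 := congrArg MulOpposite.unop hmem
  rw [TwoSidedIdeal.mem_iff]
  exact (RingCon.eq _).1 h0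

end Transfer

/-! ### The simple components of `S_e` -/

section Top

variable {R : Type u} [Ring R] {n : ℕ} {c : Fin n → R} {I : Finset (Fin n)} {e : R}

/-- The map `R → S_e`, `r ↦ er`. -/
def toTop (he : IsIdempotentElem e) : R →ₗ[Rᵐᵒᵖ] topOfIdempotent e :=
  Submodule.mkQ _ ∘ₗ
    { toFun := fun r => ⟨e * r, by rw [mem_idempotentRightIdeal he, ← mul_assoc, he.eq]⟩
      map_add' := fun r s => Subtype.ext (mul_add e r s)
      map_smul' := fun a r => Subtype.ext (by simp [MulOpposite.smul_eq_mul_unop, mul_assoc]) }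

theorem toTop_surjective (he : IsIdempotentElem e) : Function.Surjective (toTop he) := fun t => by
  obtain ⟨⟨r, hr⟩, rfl⟩ := Submodule.mkQ_surjective _ t
  exact ⟨r, congrArg (Submodule.mkQ _) (Subtype.ext ((mem_idempotentRightIdeal he).1 hr))⟩

theorem toTop_mul_left (he : IsIdempotentElem e) (r : R) : toTop he (e * r) = toTop he r :=
  congrArg (Submodule.mkQ _) (Subtype.ext (by
    change e * (e * r) = e * r
    rw [← mul_assoc, he.eq]))

theorem toTop_mul (he : IsIdempotentElem e) (r s : R) :
    toTop he (r * s) = MulOpposite.op s • toTop he r := by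
  rw [← map_smul]; rfl

theorem op_smul_eq_zero_of_mem_jacobson {x : R} (hx : x ∈ Ring.jacobson R)
    (t : topOfIdempotent e) : MulOpposite.op x • t = 0 := by
  obtain ⟨m, rfl⟩ := Submodule.mkQ_surjective _ t
  rw [← map_smul, Submodule.mkQ_apply, Submodule.Quotient.mk_eq_zero]
  exact Ring.jacobson_smul_top_le Rᵐᵒᵖ _
    (Submodule.smul_mem_smul (op_mem_jacobson hx) Submodule.mem_top)

theorem toTop_eq_zero_of_mem_jacobson (he : IsIdempotentElem e) {x : R}
    (hx : x ∈ Ring.jacobson R) : toTop he x = 0 := by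
  rw [← one_mul x, toTop_mul, op_smul_eq_zero_of_mem_jacobson hx]

theorem toTop_ne_zero (he : IsIdempotentElem e) {x : R} (hx : IsIdempotentElem x) (hx0 : x ≠ 0)
    (hex : e * x = x) : toTop he x ≠ 0 := fun h => by
  have h1 : (⟨e * x, by rw [mem_idempotentRightIdeal he, ← mul_assoc, he.eq]⟩ :
      idempotentRightIdeal e) ∈ Module.jacobson Rᵐᵒᵖ (idempotentRightIdeal e) :=
    (Submodule.Quotient.mk_eq_zero _).1 h
  let g : R →ₗ[Rᵐᵒᵖ] Rᵐᵒᵖ :=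
    { toFun := MulOpposite.op
      map_add' := fun _ _ => rfl
      map_smul' := fun _ _ => rfl }
  have h2 := Module.le_comap_jacobson (g ∘ₗ (idempotentRightIdeal e).subtype) h1
  have h3 : MulOpposite.op (e * x) ∈ Ring.jacobson Rᵐᵒᵖ := h2
  rw [hex] at h3
  exact hx0 (eq_zero_of_op_mem_jacobson h3 hx)

namespace IsBasicFamily

theorem mul_sub_mul_mem (hc : IsBasicFamily c) (i : Fin n) (r : R) :
    c i * r - c i * r * c i ∈ Ring.jacobson R := by
  have : c i * r - c i * r * c i = ∑ j ∈ Finset.univ.erase i, c i * r * c j := by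
    rw [Finset.sum_erase_eq_sub (Finset.mem_univ i), ← Finset.mul_sum, hc.complete.complete, mul_one]
  rw [this]
  exact sum_mem fun j hj => hc.mul_mul_mem i j (Finset.ne_of_mem_erase hj).symm r

theorem sub_mul_mul_mem (hc : IsBasicFamily c) (i : Fin n) (r : R) :
    r * c i - c i * r * c i ∈ Ring.jacobson R := by
  have : r * c i - c i * r * c i = ∑ j ∈ Finset.univ.erase i, c j * (r * c i) := by
    rw [Finset.sum_erase_eq_sub (Finset.mem_univ i), ← Finset.sum_mul, hc.complete.complete, one_mul,
      mul_assoc]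
  rw [this]
  exact sum_mem fun j hj => by
    rw [← mul_assoc]; exact hc.mul_mul_mem j i (Finset.ne_of_mem_erase hj) r

/-- The radical kills `S_e`, and `c i` is central modulo the radical. Hence the part of `S_e` fixed
by `c i` is a submodule. -/
theorem op_smul_comm (hc : IsBasicFamily c) (i : Fin n) (r : R) (t : topOfIdempotent e) :
    MulOpposite.op (c i) • MulOpposite.op r • t = MulOpposite.op r • MulOpposite.op (c i) • t := by
  rw [← mul_smul, ← mul_smul, ← MulOpposite.op_mul, ← MulOpposite.op_mul, ← sub_eq_zero, ← sub_smul,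
    ← MulOpposite.op_sub]
  refine op_smul_eq_zero_of_mem_jacobson ?_ t
  have := sub_mem (hc.sub_mul_mul_mem i r) (hc.mul_sub_mul_mem i r)
  rwa [sub_sub_sub_cancel_right] at this

/-- The summand of `S_e` on which `c i` acts as the identity. -/
def topComponent (hc : IsBasicFamily c) (e : R) (i : Fin n) :
    Submodule Rᵐᵒᵖ (topOfIdempotent e) where
  carrier := {t | MulOpposite.op (c i) • t = t}
  zero_mem' := smul_zero _
  add_mem' {x y} hx hy := by
    change MulOpposite.op (c i) • (x + y) = x + y
    rw [smul_add, show MulOpposite.op (c i) • x = x from hx,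
      show MulOpposite.op (c i) • y = y from hy]
  smul_mem' a x hx := by
    change MulOpposite.op (c i) • a • x = a • x
    rw [← MulOpposite.op_unop a, hc.op_smul_comm, show MulOpposite.op (c i) • x = x from hx]

theorem mem_topComponent (hc : IsBasicFamily c) {i : Fin n} {t : topOfIdempotent e} :
    t ∈ hc.topComponent e i ↔ MulOpposite.op (c i) • t = t := Iff.rfl

theorem sum_mul_eq (hc : IsBasicFamily c) {i : Fin n} (hi : i ∈ I) :
    (∑ j ∈ I, c j) * c i = c i := by
  rw [Finset.sum_mul, Finset.sum_eq_single i (fun j _ hj => hc.complete.ortho hj)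
    (fun h => absurd hi h), (hc.complete.idem i).eq]

theorem op_smul_op_smul (hc : IsBasicFamily c) (i j : Fin n) (t : topOfIdempotent e) :
    MulOpposite.op (c i) • MulOpposite.op (c j) • t =
      if i = j then MulOpposite.op (c i) • t else 0 := by
  rw [← mul_smul, ← MulOpposite.op_mul]
  split_ifs with h
  · subst h; rw [(hc.complete.idem i).eq]
  · rw [hc.complete.ortho (Ne.symm h), MulOpposite.op_zero, zero_smul]

theorem sum_op_smul (hc : IsBasicFamily c) (he : IsIdempotentElem e) (heI : e = ∑ i ∈ I, c i)
    (t : topOfIdempotent e) : ∑ i ∈ I, MulOpposite.op (c i) • t = t := by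
  have hone : ∑ i, MulOpposite.op (c i) • t = t := by
    rw [← Finset.sum_smul, ← op_finsetSum, hc.complete.complete, MulOpposite.op_one, one_smul]
  conv_rhs => rw [← hone]
  refine Finset.sum_subset (Finset.subset_univ I) fun i _ hi => ?_
  obtain ⟨r, rfl⟩ := toTop_surjective he t
  rw [← toTop_mul, ← toTop_mul_left he, ← mul_assoc]
  refine toTop_eq_zero_of_mem_jacobson he ?_
  rw [heI, Finset.sum_mul, Finset.sum_mul]
  exact sum_mem fun j hj => hc.mul_mul_mem j i (fun h => hi (h ▸ hj)) r

theorem toTop_mem_topComponent (hc : IsBasicFamily c) (he : IsIdempotentElem e) (i : Fin n) :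
    toTop he (c i) ∈ hc.topComponent e i := by
  rw [mem_topComponent, ← toTop_mul, (hc.complete.idem i).eq]

theorem exists_op_smul_eq (hc : IsBasicFamily c) (he : IsIdempotentElem e) {i : Fin n}
    {t : topOfIdempotent e} (ht : t ∈ hc.topComponent e i) :
    ∃ x, c i * x = x ∧ x * c i = x ∧ toTop he x = t := by
  obtain ⟨r, rfl⟩ := toTop_surjective he t
  refine ⟨c i * r * c i, ?_, ?_, ?_⟩
  · simp only [← mul_assoc, (hc.complete.idem i).eq]
  · rw [mul_assoc, (hc.complete.idem i).eq]
  · rw [mem_topComponent, ← toTop_mul] at ht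
    rw [← ht, ← sub_eq_zero, ← map_sub, ← neg_sub, map_neg,
      toTop_eq_zero_of_mem_jacobson he (hc.sub_mul_mul_mem i r), neg_zero]

theorem isSimpleModule_topComponent (hc : IsBasicFamily c) (he : IsIdempotentElem e)
    (heI : e = ∑ i ∈ I, c i) {i : Fin n} (hi : i ∈ I) :
    IsSimpleModule Rᵐᵒᵖ (hc.topComponent e i) := by
  have hne : toTop he (c i) ≠ 0 :=
    toTop_ne_zero he (hc.complete.idem i) (hc.ne_zero i) (by rw [heI, hc.sum_mul_eq hi])
  rw [isSimpleModule_iff_toSpanSingleton_surjective]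
  refine ⟨⟨⟨_, hc.toTop_mem_topComponent he i⟩, 0, fun h => hne (congrArg Subtype.val h)⟩, ?_⟩
  rintro ⟨z, hz⟩ hz0 ⟨w, hw⟩
  obtain ⟨x, hx1, hx2, rfl⟩ := hc.exists_op_smul_eq he hz
  obtain ⟨x', hx1', hx2', rfl⟩ := hc.exists_op_smul_eq he hw
  have hxJ : x ∉ Ring.jacobson R := fun h => hz0 (Subtype.ext (toTop_eq_zero_of_mem_jacobson he h))
  -- Locality of the corner at `c i` moves any nonzero element of the component to any other, by
  -- right multiplication with `y * x'`.
  obtain ⟨y, -, -, hy⟩ := hc.exists_mul_eq i x hx1 hx2 hxJ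
  refine ⟨MulOpposite.op (y * x'), Subtype.ext ?_⟩
  change MulOpposite.op (y * x') • toTop he x = toTop he x'
  rw [← toTop_mul, ← mul_assoc, hy, hx1']

theorem isInternal_topComponent (hc : IsBasicFamily c) (he : IsIdempotentElem e)
    (heI : e = ∑ i ∈ I, c i) {l : List (Fin n)} (hl : l.Nodup) (hlI : l.toFinset = I) :
    DirectSum.IsInternal (fun k : Fin l.length => hc.topComponent e (l.get k)) := by
  classical
  have hget : Function.Injective l.get := List.nodup_iff_injective_get.1 hl
  constructor
  · rw [injective_iff_map_eq_zero]
    intro x hx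
    rw [DirectSum.coeAddMonoidHom_eq_dfinsuppSum, DFinsupp.sum_eq_sum_fintype _ (by simp)] at hx
    change ∑ k, (x k : topOfIdempotent e) = 0 at hx
    ext k
    have h1 := congrArg (MulOpposite.op (c (l.get k)) • ·) hx
    simp only [smul_zero, Finset.smul_sum] at h1
    rw [Finset.sum_eq_single k] at h1
    · rw [hc.mem_topComponent.1 (x k).2] at h1
      exact h1
    · intro j _ hj
      rw [← hc.mem_topComponent.1 (x j).2, hc.op_smul_op_smul, if_neg fun h => hj (hget h).symm]
    · simp
  · intro t
    have hmem : ∀ i, MulOpposite.op (c i) • t ∈ hc.topComponent e i := fun i => by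
      rw [mem_topComponent, hc.op_smul_op_smul, if_pos rfl]
    refine ⟨∑ k, DirectSum.of (fun k : Fin l.length => hc.topComponent e (l.get k)) k
      ⟨_, hmem (l.get k)⟩, ?_⟩
    rw [map_sum]
    simp only [DirectSum.coeAddMonoidHom_of]
    conv_rhs => rw [← hc.sum_op_smul he heI t, ← hlI]
    refine Finset.sum_bij (fun k _ => l.get k) (fun k _ => by simp) (fun k _ k' _ h => hget h)
      (fun i hi => ?_) (fun _ _ => rfl)
    obtain ⟨k, hk⟩ := List.mem_iff_get.1 (List.mem_toFinset.1 hi)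
    exact ⟨k, Finset.mem_univ _, hk⟩

theorem mul_eq_of_op_mul_mul {f : R} (hf : IsIdempotentElem f) {x : Rᵐᵒᵖ}
    (hx : MulOpposite.op f * x * MulOpposite.op f = x) : f * x.unop = x.unop ∧ x.unop * f = x.unop := by
  have h : f * (x.unop * f) = x.unop := congrArg MulOpposite.unop hx
  constructor
  · rw [← h, ← mul_assoc, hf.eq]
  · rw [← h, mul_assoc, mul_assoc, hf.eq]

theorem isSimpleSystem_topComponent (hc : IsBasicFamily c) (he : IsIdempotentElem e)
    (heI : e = ∑ i ∈ I, c i)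
    (hartinian : IsArtinianRing
      ((TwoSidedIdeal.span {1 - e} : TwoSidedIdeal R).ringCon.Quotient)ᵐᵒᵖ)
    (hgldim : ∀ (e' : R) (he' : IsIdempotentElem e'), IsSandwiched e e' →
      rightGlobalDimension (idempotentSubring he') < ⊤) :
    IsSimpleSystem I (fun i => MulOpposite.op (c i)) (fun i => hc.topComponent e i) where
  mul_self i _ := by rw [← MulOpposite.op_mul, (hc.complete.idem i).eq]
  mul_eq_zero i _ j _ hij := by
    rw [← MulOpposite.op_mul, hc.complete.ortho hij.symm, MulOpposite.op_zero]
  isSimpleModule i hi := hc.isSimpleModule_topComponent he heI hi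
  smul_eq i _ s := Subtype.ext s.2
  isCornerLocal i _ x hx := by
    by_cases hxJ : x.unop ∈ Ring.jacobson R
    · exact Or.inl fun s => Subtype.ext (op_smul_eq_zero_of_mem_jacobson hxJ s.1)
    · obtain ⟨h1, h2⟩ := mul_eq_of_op_mul_mul (hc.complete.idem i) hx
      obtain ⟨y, -, -, hy⟩ := hc.exists_mul_eq i x.unop h1 h2 hxJ
      exact Or.inr ⟨MulOpposite.op y, MulOpposite.unop_injective hy⟩
  nilpotent i hi := by
    obtain ⟨m, hm⟩ := exists_list_prod_mem_span hartinian
    have := hc.isSimpleModule_topComponent he heI hi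
    have := IsSimpleModule.nontrivial Rᵐᵒᵖ (hc.topComponent e i)
    obtain ⟨s, hs⟩ := exists_ne (0 : hc.topComponent e i)
    refine ⟨m, fun l hl hlm => ?_⟩
    -- An element of the corner annihilating the component lies in the radical: otherwise it would
    -- be invertible there and `c i` would act as zero.
    have hmem := hm l hl fun x hx => by
      obtain ⟨h, hxs⟩ := hlm x hx
      obtain ⟨h1, h2⟩ := mul_eq_of_op_mul_mul (hc.complete.idem i) h
      by_contra hxJ
      obtain ⟨y, -, -, hy⟩ := hc.exists_mul_eq i x.unop h1 h2 hxJ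
      refine hs (Subtype.ext ?_)
      have h3 : MulOpposite.op (c i) • s = 0 := by
        rw [← hy, MulOpposite.op_mul, mul_smul, MulOpposite.op_unop, hxs, smul_zero]
      exact (hc.mem_topComponent.1 s.2).symm.trans (congrArg Subtype.val h3)
    rw [TwoSidedIdeal.mem_span_iff_mem_addSubgroup_closure] at hmem
    rw [← MulOpposite.op_unop l.prod, ← op_finsetSum, ← heI]
    generalize l.prod.unop = y at hmem
    induction hmem using AddSubgroup.closure_induction with
    | mem y hy =>
      obtain ⟨_, ⟨a, -, _, rfl, rfl⟩, b, -, rfl⟩ := hy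
      refine AddSubgroup.subset_closure ⟨MulOpposite.op (c i) * MulOpposite.op b,
        MulOpposite.op a, MulOpposite.unop_injective ?_⟩
      simp [mul_assoc]
    | zero => rw [MulOpposite.op_zero, mul_zero]; exact zero_mem _
    | add y z _ _ hy hz => rw [MulOpposite.op_add, mul_add]; exact add_mem hy hz
    | neg y _ hy => rw [MulOpposite.op_neg, mul_neg]; exact neg_mem hy
  hasFiniteCorners := hc.hasFiniteCorners (heI ▸ hgldim)

end IsBasicFamily

end Top

theorem mainTheorem6 {R : Type u} [Ring R]
    (hsemiperfect : IsSemiperfectRing R)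
    (hleft : IsNoetherianRing R) (hright : IsNoetherianRing Rᵐᵒᵖ)
    (hbasic : IsBasicRing R)
    (e : R) (he : IsIdempotentElem e)
    (hartinian : IsArtinianRing ((TwoSidedIdeal.span {1 - e} : TwoSidedIdeal R).ringCon.Quotient)ᵐᵒᵖ)
    (hgldim : ∀ (e' : R) (he' : IsIdempotentElem e'), IsSandwiched e e' →
      rightGlobalDimension (idempotentSubring he') < ⊤) :
    ∃ (n : ℕ) (S : Fin n → Submodule Rᵐᵒᵖ (topOfIdempotent e)),
      DirectSum.IsInternal S ∧
      (∀ i, IsSimpleModule Rᵐᵒᵖ (S i)) ∧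
      ∀ i j : Fin n, j ≤ i → ∀ k : ℕ, 0 < k →
        Subsingleton (CategoryTheory.Abelian.Ext
          (ModuleCat.of Rᵐᵒᵖ (S i)) (ModuleCat.of Rᵐᵒᵖ (S j)) k) := by
  obtain ⟨m, p, hp⟩ := hsemiperfect.exists_isBasicFamily hbasic
  obtain ⟨c, I, hc, heI⟩ := hp.exists_eq_sum he
  obtain ⟨l, hl, hlI, hlp, hself⟩ := exists_order_extVanishes I
    (hc.isSimpleSystem_topComponent he heI hartinian hgldim)
  refine ⟨l.length, fun k => hc.topComponent e (l.get k), hc.isInternal_topComponent he heI hl hlI,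
    fun k => hc.isSimpleModule_topComponent he heI ?_, fun i j hij k hk => ?_⟩
  · rw [← hlI, List.mem_toFinset]; exact List.get_mem l k
  · rcases hij.lt_or_eq with h | rfl
    · exact List.pairwise_iff_get.1 hlp j i h k hk
    · exact hself _ (List.get_mem l j) k hk
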